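/- Let $q\in(0,1)$, $\zeta_-<0<\zeta_+$, and let $\mathbb L=\{\zeta_-q^m: m\in\mathbb Z\}\sqcup\{\zeta_+q^n: n\in\mathbb Z\}\subset\mathbb R\setminus\{0\}$ be the double $q$-lattice. For $N\ge 1$ let $\mathbb G_N$ be the set of $N$-point subsets $X=\{x_1<\dots<x_N\}$ of $\mathbb L$, and let $\mathbb G_\infty$ be the set of infinite bounded subsets of $\mathbb L$. For $a<b$ in $\mathbb L$ let $I(a,b)$ be $[a,b)\cap\mathbb L$ if $a<b<0$, $[a,b]\cap\mathbb L$ if $a<0<b$, and $(a,b]\cap\mathbb L$ if $0<a<b$. For $X\in\mathbb G_{N+1}$ and $Y\in\mathbb G_N$ write $Y\prec X$ if $y_i\in I(x_i,x_{i+1})$ for $i=1,\dots,N$. The $q$-links are the stochastic matrices $$\Lambda^{N+1}_N(X,Y)=|y_1|\cdots|y_N|\,(1-q)(1-q^2)\cdots(1-q^N)\,\frac{\prod_{1\le i<j\le N}(y_j-y_i)}{\prod_{1\le i<j\le N+1}(x_j-x_i)}\quad\text{if }Y\prec X,$$ and $\Lambda^{N+1}_N(X,Y)=0$ otherwise; set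 $\Lambda^N_K=\Lambda^N_{N-1}\cdots\Lambda^{K+1}_K$ for $N>K\ge1$. A sequence $\{X(N)\in\mathbb G_N\}_{N\ge1}$ is called regular if for every $K\ge1$ there is a probability measure $M_K$ on the discrete set $\mathbb G_K$ such that $\Lambda^N_K(X(N),A)\to M_K(A)$ as $N\to\infty$ for every $A\subseteq\mathbb G_K$. Two regular sequences are equivalent if their limit measures $M_K$ coincide for all $K$; the Martin boundary of the chain $\{\mathbb G_N,\Lambda^{N+1}_N\}$ is the set of equivalence classes of regular sequences. The variational series $(x_{(1)},x_{(2)},\dots)$ of a bounded subset $X\subset\mathbb L$ lists the points of $X$ in decreasing order of absolute value (of two points with the same absolute value the positive one comes first), and is completed with zeros if $X$ is finite. A sequence $\{X(N)\in\mathbb G_N\}$ stabilizes to $X\in\mathbb G_\infty$ if for every $k\ge1$ one has $x_{(k)}(N)=x_{(k)}$ for all sufficiently large $N$. **Theorem.** A sequence $\{X(N)\in\mathbb G_N\}_{N\ge1}$ is regular if and only if it stabilizes to some configuration $X\in\mathbb G_\infty$. The correspondence $\{X(N)\}\mapsto X$ is well defined on equivalence classes of regular sequences and gives a bijection of the Martin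 boundary of the chain $\{\mathbb G_N,\Lambda^{N+1}_N\}$ onto $\mathbb G_\infty$. -/

import Mathlib

open Filter
open scoped ENNReal Topology

namespace ExtGT

noncomputable section

/-! ### The Martin boundary of a chain of discrete spaces

A chain `⋯ ⇢ Ω_{N+1} ⇢ Ω_N ⇢ ⋯ ⇢ Ω_1` is encoded by a family `Ω : ℕ → Type*`, where `Ω n` is the
`(n+1)`-st space of the chain, together with the matrices `Λ n` of format `Ω (n+1) × Ω n` with
entries in `[0, ∞]`. -/

section Chain

universe u

variable {Ω : ℕ → Type u} (Λ : ∀ n, Ω (n + 1) → Ω n → ℝ≥0∞)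

/-- The composite matrix `Λ^{K+d}_K = Λ^{K+d}_{K+d-1} ⋯ Λ^{K+1}_K` (the identity matrix
for `d = 0`). -/
def compLink (K : ℕ) : ∀ d : ℕ, Ω (K + d) → Ω K → ℝ≥0∞
  | 0 => fun x y => open Classical in if x = y then 1 else 0
  | d + 1 => fun x y => ∑' z : Ω (K + d), Λ (K + d) x z * compLink K d z y

/-- The row measures `Λ^N_K(x(N), ·)` converge, as `N → ∞`, to the probability measure `M` on the
discrete space `Ω K`, i.e. they converge on every subset `A` of `Ω K`. Here `N = K + d`. -/
def RowsConverge (x : ∀ n, Ω n) (K : ℕ) (M : PMF (Ω K)) : Prop :=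
  ∀ A : Set (Ω K),
    Tendsto (fun d : ℕ => ∑' y : A, compLink Λ K d (x (K + d)) y) atTop (𝓝 (∑' y : A, M y))

/-- A sequence is regular if for every `K` the row measures `Λ^N_K(x(N), ·)` have a limit that is
a probability measure on `Ω K`. -/
def IsRegular (x : ∀ n, Ω n) : Prop :=
  ∀ K, ∃ M : PMF (Ω K), RowsConverge Λ x K M

/-- The set of regular sequences. -/
def RegularSeq : Type u := {x : ∀ n, Ω n // IsRegular Λ x}

/-- The limit measures `M_K` of a regular sequence (they are unique, since limits in `[0, ∞]`
are). -/
def limitMeasure (x : RegularSeq Λ) (K : ℕ) : PMF (Ω K) := (x.2 K).choose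

/-- Two regular sequences are equivalent if their limit measures coincide for all `K`. -/
def regularSetoid : Setoid (RegularSeq Λ) := Setoid.ker (limitMeasure Λ)

/-- The Martin boundary: the set of equivalence classes of regular sequences. -/
def MartinBoundary : Type u := Quotient (regularSetoid Λ)

/-- The point of the Martin boundary represented by a regular sequence. -/
def MartinBoundary.mk (x : RegularSeq Λ) : MartinBoundary Λ := Quotient.mk (regularSetoid Λ) x

end Chain

/-! ### The extended Gelfand-Tsetlin graph and the `q`-links -/

section Graph

variable (q ζm ζp : ℝ)

/-- The double `q`-lattice. -/
def qLattice : Set ℝ := {x | (∃ m : ℤ, x = ζm * q ^ m) ∨ (∃ n : ℤ, x = ζp * q ^ n)}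

/-- The set `𝔾_N` of `N`-particle configurations on the lattice. -/
def Level (N : ℕ) : Type := {X : Finset ℝ // (X : Set ℝ) ⊆ qLattice q ζm ζp ∧ X.card = N}

/-- The set `𝔾_∞` of infinite bounded configurations on the lattice. -/
def GInf : Type :=
  {X : Set ℝ // X ⊆ qLattice q ζm ζp ∧ X.Infinite ∧ ∃ a b : ℝ, X ⊆ Set.Icc a b}

variable {q ζm ζp}

/-- The particles `x_1 < ⋯ < x_N` of a configuration in increasing order (indexed from `0`). -/
def Level.pt {N : ℕ} (X : Level q ζm ζp N) : Fin N → ℝ := X.1.orderEmbOfFin X.2.2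

/-- The product of the differences `x_j - x_i` over `i < j`. -/
def vdm {N : ℕ} (x : Fin N → ℝ) : ℝ := ∏ i, ∏ j ∈ Finset.Ioi i, (x j - x i)

variable (q ζm ζp)

/-- The interval `I(a, b)` between two lattice points `a < b`: it is `[a, b)` if `a < b < 0`,
`(a, b]` if `0 < a < b`, and `[a, b]` if `a < 0 < b`, intersected with the lattice. -/
def qInterval (a b : ℝ) : Set ℝ :=
  (if b < 0 then Set.Ico a b else if 0 < a then Set.Ioc a b else Set.Icc a b) ∩ qLattice q ζm ζp

/-- The interlacement relation `Y ≺ X`. -/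
def Interlace {N : ℕ} (Y : Level q ζm ζp N) (X : Level q ζm ζp (N + 1)) : Prop :=
  ∀ i : Fin N, Y.pt i ∈ qInterval q ζm ζp (X.pt i.castSucc) (X.pt i.succ)

/-- The cotransition probabilities `Λ^{N+1}_N(X, Y)`, as real numbers. -/
def cotransition (N : ℕ) (X : Level q ζm ζp (N + 1)) (Y : Level q ζm ζp N) : ℝ :=
  open Classical in
  if Interlace q ζm ζp Y X then
    (∏ i, |Y.pt i|) * (∏ i ∈ Finset.range N, (1 - q ^ (i + 1))) * (vdm Y.pt / vdm X.pt)
  else 0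

variable {q ζm ζp} in
theorem vdm_pt_pos {N : ℕ} (X : Level q ζm ζp N) : 0 < vdm X.pt :=
  Finset.prod_pos fun _ _ => Finset.prod_pos fun _ hj =>
    sub_pos.2 ((X.1.orderEmbOfFin X.2.2).strictMono (Finset.mem_Ioi.1 hj))

/-- The cotransition probabilities are nonnegative, so that nothing is lost when they are regarded
as elements of `[0, ∞]`. -/
theorem cotransition_nonneg (hq0 : 0 < q) (hq1 : q < 1) (N : ℕ) (X : Level q ζm ζp (N + 1))
    (Y : Level q ζm ζp N) : 0 ≤ cotransition q ζm ζp N X Y := by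
  unfold cotransition
  split_ifs
  · refine mul_nonneg (mul_nonneg (Finset.prod_nonneg fun _ _ => abs_nonneg _)
      (Finset.prod_nonneg fun i _ => sub_nonneg.2 (pow_le_one₀ hq0.le hq1.le)))
      (div_nonneg (vdm_pt_pos Y).le (vdm_pt_pos X).le)
  · exact le_rfl

/-- The spaces of the chain `⋯ ⇢ 𝔾_3 ⇢ 𝔾_2 ⇢ 𝔾_1`: the space with index `n` is `𝔾_{n+1}`. -/
abbrev GSpace (n : ℕ) : Type := Level q ζm ζp (n + 1)

/-- The chain of `q`-links `𝔾_{N+1} ⇢ 𝔾_N`, `N = n + 1 = 1, 2, …`. -/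
def qLink (n : ℕ) (X : GSpace q ζm ζp (n + 1)) (Y : GSpace q ζm ζp n) : ℝ≥0∞ :=
  ENNReal.ofReal (cotransition q ζm ζp (n + 1) X Y)

end Graph

/-! ### The variational series -/

/-- `x` comes strictly before `y` in the order of decreasing absolute values, where of two points
with equal absolute values the positive one comes first. -/
def Before (x y : ℝ) : Prop := |y| < |x| ∨ (|x| = |y| ∧ y < x)

/-- The variational series of a bounded configuration `X`, indexed from `0`: the `k`-th term is the
point of `X` that has exactly `k` points of `X` before it, and it is `0` if there is none (which
happens when `X` has at most `k` points). -/
def varSeries (X : Set ℝ) (k : ℕ) : ℝ :=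
  open Classical in
  if h : ∃ x ∈ X, {y ∈ X | Before y x}.encard = k then h.choose else 0

/-- The sequence `X(N) ∈ 𝔾_N`, `N = 1, 2, …` (where `X n` is `X(n+1)`) stabilizes to the infinite
bounded configuration `Z`: every term of the variational series of `X(N)` is equal to that of `Z`
for all large `N`. -/
def Stabilizes {q ζm ζp : ℝ} (X : ∀ n, GSpace q ζm ζp n) (Z : GInf q ζm ζp) : Prop :=
  ∀ k : ℕ, ∃ n₀ : ℕ, ∀ n ≥ n₀, varSeries ((X n).1 : Set ℝ) k = varSeries Z.1 k

end

end ExtGT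

namespace ExtGT

noncomputable section

variable {q ζm ζp : ℝ}

/-! ### The double lattice -/

/-! Let J be the Jackson integral `qInt`. A sum of det[φ_j(y_i)], weighted by |y_1⋯y_N|, over all Y
interlacing with X splits by multilinearity: each row is summed over its own interval, giving
differences of Jφ_j. Hence a link maps the quotient of an alternant by the Vandermonde product to a
constant times the same quotient for the functions 1, Jφ_0, Jφ_1, … (`hasSum_cotransition_alt`).
Starting from the indicators of the points of Y, d links produce d monomials that no longer depend
on Y, followed by the functions J^d of those indicators. Expanding along these last columns turns an
entry of the composite link into an iterated sum over distinct points a of X, with as many nested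
sums as Y has points and weights 1/∏_{x ≠ a}(1 - x/a) (`compReal_eq`).

In this form the limit can be taken. The points of the lattice decay geometrically, so the products
over x ≠ a converge under pointwise convergence of bounded configurations and are bounded away from
zero (`tendsto_coprod`, `coprod_lower_bound`). The normalized functions a^{-d} J^d converge as well
(`tendsto_deltaLim`). If X keeps enough points away from 0, the weights are small at small a.
Dominated convergence then gives convergence of the entries and of the row measures, without loss of
mass (`tendsto_compReal`, `Converges.exists_pmf`).

Conversely, the row on one-point configurations gives mass bounded below to the point of X of
largest modulus, so tightness bounds X(N) (`exists_window_of_rowsConverge`). A positive limit entry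
at a K-point Y forces K points of X(N) to stay away from 0
(`exists_hasLargePoints_of_rowsConverge`). By compactness X(N) then has pointwise limits along
ultrafilters. The limit measure on one-point configurations determines such a limit, because it is a
triangular transform of nonzero weights on the points (`eq_of_limReal_zero_eq`). So all these limits
agree and X(N) converges. Stabilization of the variational series is the same as pointwise
convergence of bounded configurations to an infinite one (`Converges.stabilizes`,
`Stabilizes.converges`). -/

theorem ne_zero_of_mem_qLattice (hq : 0 < q) (hm : ζm < 0) (hp : 0 < ζp) {x : ℝ}
    (hx : x ∈ qLattice q ζm ζp) : x ≠ 0 := by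
  rcases hx with ⟨k, rfl⟩ | ⟨k, rfl⟩
  · exact mul_ne_zero hm.ne (zpow_pos hq k).ne'
  · exact mul_ne_zero hp.ne' (zpow_pos hq k).ne'

theorem mul_zpow_mem_qLattice (hq : 0 < q) {x : ℝ} (hx : x ∈ qLattice q ζm ζp) (k : ℤ) :
    x * q ^ k ∈ qLattice q ζm ζp := by
  rcases hx with ⟨n, rfl⟩ | ⟨n, rfl⟩
  · exact Or.inl ⟨n + k, by rw [zpow_add₀ hq.ne', mul_assoc]⟩
  · exact Or.inr ⟨n + k, by rw [zpow_add₀ hq.ne', mul_assoc]⟩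

theorem exists_zpow_of_mem_qLattice (hq : 0 < q) (hm : ζm < 0) (hp : 0 < ζp) {x y : ℝ}
    (hx : x ∈ qLattice q ζm ζp) (hy : y ∈ qLattice q ζm ζp) (hxy : 0 < x * y) :
    ∃ k : ℤ, y = x * q ^ k := by
  rcases hx with ⟨n, rfl⟩ | ⟨n, rfl⟩ <;> rcases hy with ⟨m, rfl⟩ | ⟨m, rfl⟩
  · exact ⟨m - n, by rw [mul_assoc, ← zpow_add₀ hq.ne', add_sub_cancel]⟩
  · exact absurd hxy (mul_neg_of_neg_of_pos (mul_neg_of_neg_of_pos hm (zpow_pos hq n))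
      (mul_pos hp (zpow_pos hq m))).not_gt
  · exact absurd hxy (mul_neg_of_pos_of_neg (mul_pos hp (zpow_pos hq n))
      (mul_neg_of_neg_of_pos hm (zpow_pos hq m))).not_gt
  · exact ⟨m - n, by rw [mul_assoc, ← zpow_add₀ hq.ne', add_sub_cancel]⟩

theorem abs_le_mul_of_abs_lt (hq : 0 < q) (hq1 : q < 1) (hm : ζm < 0) (hp : 0 < ζp) {x y : ℝ}
    (hx : x ∈ qLattice q ζm ζp) (hy : y ∈ qLattice q ζm ζp) (hxy : 0 < x * y) (h : |x| < |y|) :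
    |x| ≤ q * |y| := by
  obtain ⟨k, rfl⟩ := exists_zpow_of_mem_qLattice hq hm hp hy hx (by rwa [mul_comm])
  have hk : 0 < k := by
    by_contra! hk
    have : 1 ≤ q ^ k := one_le_zpow_of_nonpos₀ hq hq1.le hk
    rw [abs_mul, abs_of_pos (zpow_pos hq k)] at h
    nlinarith [abs_nonneg y]
  rw [abs_mul, abs_of_pos (zpow_pos hq k), mul_comm]
  refine mul_le_mul_of_nonneg_right ?_ (abs_nonneg y)
  simpa using zpow_le_zpow_right_of_le_one₀ hq hq1.le (show (1 : ℤ) ≤ k by omega)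

/-- The points `x, x q, x q ^ 2, …`. -/
def orbit (q x : ℝ) : Set ℝ := Set.range fun r : ℕ => x * q ^ r

theorem injective_orbit (hq : 0 < q) (hq1 : q < 1) {x : ℝ} (hx : x ≠ 0) :
    Function.Injective fun r : ℕ => x * q ^ r := fun _ _ h =>
  pow_right_injective₀ hq hq1.ne (mul_left_cancel₀ hx h)

theorem mem_orbit_iff (hq : 0 < q) (hq1 : q < 1) (hm : ζm < 0) (hp : 0 < ζp) {x y : ℝ}
    (hx : x ∈ qLattice q ζm ζp) :
    y ∈ orbit q x ↔ y ∈ qLattice q ζm ζp ∧ 0 < x * y ∧ |y| ≤ |x| := by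
  have hx0 := ne_zero_of_mem_qLattice hq hm hp hx
  constructor
  · rintro ⟨r, rfl⟩
    refine ⟨by simpa using mul_zpow_mem_qLattice hq hx r, ?_, ?_⟩
    · have := pow_pos hq r
      have := mul_self_pos.2 hx0
      simp only [← mul_assoc]
      positivity
    · simp only [abs_mul, abs_pow, abs_of_pos hq]
      exact mul_le_of_le_one_right (abs_nonneg x) (pow_le_one₀ hq.le hq1.le)
  · rintro ⟨hy, hxy, h⟩
    obtain ⟨k, rfl⟩ := exists_zpow_of_mem_qLattice hq hm hp hx hy hxy
    have hk : 0 ≤ k := by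
      by_contra! hk
      rw [abs_mul, abs_of_pos (zpow_pos hq k)] at h
      have : 1 < q ^ k := one_lt_zpow_of_neg₀ hq hq1 hk
      nlinarith [abs_pos.2 hx0]
    lift k to ℕ using hk
    exact ⟨k, by simp⟩

/-! ### The `q`-integral -/

/-- The (normalized) Jackson integral of `f` from `0` to `x`. -/
def qInt (q : ℝ) (f : ℝ → ℝ) (x : ℝ) : ℝ := ∑' r : ℕ, x * q ^ r * f (x * q ^ r)

/-- Functions that are bounded on bounded sets. -/
def LocBdd (f : ℝ → ℝ) : Prop := ∀ R : ℝ, ∃ C : ℝ, ∀ x, |x| ≤ R → |f x| ≤ C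

theorem abs_mul_pow_le (hq : 0 < q) (hq1 : q < 1) (x : ℝ) (r : ℕ) : |x * q ^ r| ≤ |x| := by
  rw [abs_mul, abs_pow, abs_of_pos hq]
  exact mul_le_of_le_one_right (abs_nonneg x) (pow_le_one₀ hq.le hq1.le)

theorem qInt_term_bound (hq : 0 < q) (hq1 : q < 1) {f : ℝ → ℝ} {x C : ℝ}
    (hC : ∀ y, |y| ≤ |x| → |f y| ≤ C) (r : ℕ) :
    ‖x * q ^ r * f (x * q ^ r)‖ ≤ |x| * C * q ^ r := by
  rw [Real.norm_eq_abs, abs_mul, abs_mul, abs_pow, abs_of_pos hq, mul_right_comm]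
  exact mul_le_mul_of_nonneg_right (mul_le_mul_of_nonneg_left
    (hC _ (abs_mul_pow_le hq hq1 x r)) (abs_nonneg x)) (pow_nonneg hq.le r)

theorem LocBdd.summable_qInt (hq : 0 < q) (hq1 : q < 1) {f : ℝ → ℝ} (hf : LocBdd f) (x : ℝ) :
    Summable fun r : ℕ => x * q ^ r * f (x * q ^ r) := by
  obtain ⟨C, hC⟩ := hf |x|
  exact Summable.of_norm_bounded ((summable_geometric_of_lt_one hq.le hq1).mul_left (|x| * C))
    (qInt_term_bound hq hq1 hC)

theorem abs_qInt_le (hq : 0 < q) (hq1 : q < 1) {f : ℝ → ℝ} {x C : ℝ}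
    (hC : ∀ y, |y| ≤ |x| → |f y| ≤ C) : |qInt q f x| ≤ |x| * C * (1 - q)⁻¹ := by
  have h := (hasSum_geometric_of_lt_one hq.le hq1).mul_left (|x| * C)
  exact tsum_of_norm_bounded h (qInt_term_bound hq hq1 hC)

theorem LocBdd.qInt (hq : 0 < q) (hq1 : q < 1) {f : ℝ → ℝ} (hf : LocBdd f) :
    LocBdd (qInt q f) := by
  intro R
  obtain ⟨C, hC⟩ := hf R
  refine ⟨R * |C| * (1 - q)⁻¹, fun x hx => (abs_qInt_le hq hq1 (C := |C|) fun y hy =>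
    (hC y (hy.trans hx)).trans (le_abs_self C)).trans ?_⟩
  have : 0 < 1 - q := sub_pos.2 hq1
  gcongr

/-- The functional equation of the Jackson integral. -/
theorem qInt_eq_add (hq : 0 < q) (hq1 : q < 1) {f : ℝ → ℝ} (hf : LocBdd f) (x : ℝ) :
    qInt q f x = x * f x + qInt q f (x * q) := by
  rw [ExtGT.qInt, (hf.summable_qInt hq hq1 x).tsum_eq_zero_add, ExtGT.qInt]
  simp [pow_succ', mul_assoc]

theorem qInt_pow (hq : 0 < q) (hq1 : q < 1) (m : ℕ) (c x : ℝ) :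
    qInt q (fun x => c * x ^ m) x = c * (1 - q ^ (m + 1))⁻¹ * x ^ (m + 1) := by
  have h := hasSum_geometric_of_lt_one (pow_nonneg hq.le (m + 1))
    (pow_lt_one₀ hq.le hq1 m.succ_ne_zero)
  rw [mul_right_comm, ← h.tsum_eq, ← tsum_mul_left, qInt]
  refine tsum_congr fun r => ?_
  rw [← pow_mul, mul_comm (m + 1) r, pow_mul]
  ring

theorem hasSum_qInt (hq : 0 < q) (hq1 : q < 1) {f : ℝ → ℝ} (hf : LocBdd f) {x : ℝ} (hx : x ≠ 0) :
    HasSum ((orbit q x).indicator fun y => y * f y) (qInt q f x) := by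
  rw [← (injective_orbit hq hq1 hx).hasSum_iff]
  · refine (hf.summable_qInt hq hq1 x).hasSum.congr_fun fun r => ?_
    exact Set.indicator_of_mem (Set.mem_range_self r) _
  · intro y hy
    exact Set.indicator_of_notMem hy _

/-- The orbits of a and b run towards 0. For endpoints of the same sign one orbit contains the other
and the difference is a half-open interval; for opposite signs the two orbits together fill it. The
sign of y becomes |y|. This explains the choice of endpoints in `qInterval`. -/
theorem hasSum_qInterval (hq : 0 < q) (hq1 : q < 1) (hm : ζm < 0) (hp : 0 < ζp) {f : ℝ → ℝ}
    (hf : LocBdd f) {a b : ℝ} (ha : a ∈ qLattice q ζm ζp) (hb : b ∈ qLattice q ζm ζp)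
    (hab : a < b) :
    HasSum ((qInterval q ζm ζp a b).indicator fun y => |y| * f y) (qInt q f b - qInt q f a) := by
  have ha0 := ne_zero_of_mem_qLattice hq hm hp ha
  have hb0 := ne_zero_of_mem_qLattice hq hm hp hb
  refine ((hasSum_qInt hq hq1 hf hb0).sub (hasSum_qInt hq hq1 hf ha0)).congr_fun ?_
  intro y
  by_cases hy : y ∈ qLattice q ζm ζp
  swap
  · rw [Set.indicator_of_notMem, Set.indicator_of_notMem, Set.indicator_of_notMem, sub_zero]
    · exact fun h => hy ((mem_orbit_iff hq hq1 hm hp ha).1 h).1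
    · exact fun h => hy ((mem_orbit_iff hq hq1 hm hp hb).1 h).1
    · exact fun h => hy h.2
  have hy0 := ne_zero_of_mem_qLattice hq hm hp hy
  classical
  simp only [Set.indicator_apply, mem_orbit_iff hq hq1 hm hp ha, mem_orbit_iff hq hq1 hm hp hb,
    hy, true_and, qInterval, Set.mem_inter_iff, and_true]
  rcases hy0.lt_or_gt with hy' | hy' <;> rcases ha0.lt_or_gt with ha' | ha' <;>
    rcases hb0.lt_or_gt with hb' | hb' <;>
    simp only [hy', ha', hb', abs_of_pos, abs_of_neg, mul_pos_of_neg_of_neg, mul_pos,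
      (mul_neg_of_neg_of_pos _ _).not_gt, (mul_neg_of_pos_of_neg _ _).not_gt, if_true, if_false,
      true_and, false_and, hb'.not_gt, ha'.not_gt, Set.mem_Ico, Set.mem_Ioc, Set.mem_Icc] <;>
    split_ifs <;> grind

/-! ### Summation over finite products -/

/-- Absolute summability is carried through the induction, since it is what allows the product of
two sums to be rearranged. -/
theorem summable_norm_and_hasSum_prod {β : Type*} {N : ℕ} {f : Fin N → β → ℝ} {s : Fin N → ℝ}
    (h : ∀ i, HasSum (f i) (s i)) :
    Summable (fun y : Fin N → β => ‖∏ i, f i (y i)‖) ∧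
      HasSum (fun y : Fin N → β => ∏ i, f i (y i)) (∏ i, s i) := by
  induction N with
  | zero =>
    simp only [Finset.univ_eq_empty, Finset.prod_empty]
    exact ⟨(hasSum_fintype _).summable, by simp⟩
  | succ N ih =>
    obtain ⟨ih₁, ih₂⟩ := ih fun i => h i.succ
    have h0 := (h 0).summable.norm
    have hs : Summable fun p : β × (Fin N → β) => ‖f 0 p.1 * ∏ i : Fin N, f i.succ (p.2 i)‖ :=
      Summable.mul_norm (f := f 0) (g := fun p : Fin N → β => ∏ i : Fin N, f i.succ (p i)) h0 ih₁
    have hs' := HasSum.mul (f := f 0) (g := fun p : Fin N → β => ∏ i : Fin N, f i.succ (p i))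
      (h 0) ih₂ hs.of_norm
    let e : β × (Fin N → β) ≃ (Fin (N + 1) → β) := Fin.consEquiv fun _ => β
    have he : ∀ p : β × (Fin N → β),
        ∏ i, f i (e p i) = f 0 p.1 * ∏ i : Fin N, f i.succ (p.2 i) := fun p =>
      Fin.prod_univ_succ _
    constructor
    · rw [← e.summable_iff]
      exact hs.congr fun p => congrArg norm (he p).symm
    · rw [← e.hasSum_iff, Fin.prod_univ_succ]
      exact hs'.congr_fun fun p => he p

/-! ### Generalized alternants -/

/-- The determinant `det [φ j (x i)]` with `n` rows and columns. -/
def alt (φ : ℕ → ℝ → ℝ) {n : ℕ} (x : Fin n → ℝ) : ℝ :=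
  (Matrix.of fun i j : Fin n => φ j (x i)).det

/-- Integrate every function of a sequence and prepend the constant function `1`. -/
def qLift (q : ℝ) (φ : ℕ → ℝ → ℝ) : ℕ → ℝ → ℝ
  | 0 => fun _ => 1
  | j + 1 => qInt q (φ j)

theorem LocBdd.qLift (hq : 0 < q) (hq1 : q < 1) {φ : ℕ → ℝ → ℝ} (hφ : ∀ j, LocBdd (φ j)) (j : ℕ) :
    LocBdd (qLift q φ j) := by
  cases j with
  | zero => exact fun _ => ⟨1, fun _ _ => by simp [ExtGT.qLift]⟩
  | succ j => exact (hφ j).qInt hq hq1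

/-- Subtracting from each row its predecessor leaves a first column (1, 0, …, 0), so one size drops
out. -/
theorem alt_qLift (φ : ℕ → ℝ → ℝ) {n : ℕ} (x : Fin (n + 1) → ℝ) :
    alt (qLift q φ) x = (Matrix.of fun i j : Fin n =>
      qInt q (φ j) (x i.succ) - qInt q (φ j) (x i.castSucc)).det := by
  have h := Matrix.det_eq_of_forall_row_eq_smul_add_pred (fun _ => 1)
    (A := Matrix.of fun i j : Fin (n + 1) => qLift q φ j (x i))
    (B := Matrix.of (Fin.cons (fun j => qLift q φ j (x 0))
      fun i j => qLift q φ j (x i.succ) - qLift q φ j (x i.castSucc)))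
    (fun j => rfl) (fun i j => by simp)
  rw [alt, h, Matrix.det_succ_column_zero, Finset.sum_eq_single 0]
  · simp [qLift, Matrix.submatrix]
  · intro i _ hi
    obtain ⟨i, rfl⟩ := Fin.exists_succ_eq.2 hi
    simp [qLift]
  · simp

theorem alt_vandermonde {n : ℕ} (c : ℕ → ℝ) (x : Fin n → ℝ) :
    alt (fun j x => c j * x ^ j) x = (∏ j ∈ Finset.range n, c j) * vdm x := by
  rw [alt, vdm, ← Matrix.det_vandermonde, Finset.prod_range,
    show (Matrix.of fun i j : Fin n => c j * x i ^ (j : ℕ)) =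
      Matrix.of fun i j : Fin n => (fun k : Fin n => c k) j * Matrix.vandermonde x i j from rfl,
    Matrix.det_mul_row]

/-! ### Configurations as increasing tuples -/

theorem Level.pt_strictMono {N : ℕ} (X : Level q ζm ζp N) : StrictMono X.pt :=
  (X.1.orderEmbOfFin X.2.2).strictMono

theorem Level.pt_mem {N : ℕ} (X : Level q ζm ζp N) (i : Fin N) : X.pt i ∈ X.1 :=
  X.1.orderEmbOfFin_mem X.2.2 i

theorem Level.pt_mem_qLattice {N : ℕ} (X : Level q ζm ζp N) (i : Fin N) :
    X.pt i ∈ qLattice q ζm ζp := X.2.1 (X.pt_mem i)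

theorem Level.range_pt {N : ℕ} (X : Level q ζm ζp N) : Set.range X.pt = X.1 :=
  X.1.range_orderEmbOfFin X.2.2

theorem Level.pt_injective (N : ℕ) :
    Function.Injective (Level.pt : Level q ζm ζp N → Fin N → ℝ) := by
  intro X Y h
  apply Subtype.ext
  rw [← Finset.coe_inj, ← X.range_pt, ← Y.range_pt, h]

theorem exists_level_pt_eq {N : ℕ} {y : Fin N → ℝ} (hy : StrictMono y)
    (hL : ∀ i, y i ∈ qLattice q ζm ζp) : ∃ Y : Level q ζm ζp N, Y.pt = y := by
  have hc : (Finset.univ.image y).card = N := by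
    rw [Finset.card_image_of_injective _ hy.injective, Finset.card_fin]
  refine ⟨⟨Finset.univ.image y, ?_, hc⟩, ?_⟩
  · intro x hx
    obtain ⟨i, -, rfl⟩ := Finset.mem_image.1 hx
    exact hL i
  · exact (Finset.orderEmbOfFin_unique hc (fun i => Finset.mem_image_of_mem y (Finset.mem_univ i))
      hy).symm

/-- Consecutive intervals meet at most in their common endpoint. The left one omits it if it is
negative, the right one if it is positive. Hence interlacing tuples are automatically
configurations, and the sum over Y becomes a sum over a full product of intervals. -/
theorem strictMono_of_mem_qInterval {N : ℕ} {x : Fin (N + 1) → ℝ} (hx : StrictMono x)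
    (hx0 : ∀ i, x i ≠ 0) {y : Fin N → ℝ} (hy : ∀ i, y i ∈ qInterval q ζm ζp (x i.castSucc) (x i.succ)) :
    StrictMono y := by
  cases N with
  | zero => exact fun i => i.elim0
  | succ N =>
    refine Fin.strictMono_iff_lt_succ.2 fun i => ?_
    have h1 := (hy i.castSucc).1
    have h2 := (hy i.succ).1
    have h3 : x i.castSucc.castSucc < x i.castSucc.succ := hx (Fin.castSucc_lt_succ)
    have h4 : x i.succ.castSucc < x i.succ.succ := hx (Fin.castSucc_lt_succ)
    have h6 := hx0 i.castSucc.succ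
    have h5 : x i.castSucc.succ = x i.succ.castSucc := by rw [Fin.succ_castSucc]
    split_ifs at h1 h2 <;> simp only [Set.mem_Ico, Set.mem_Ioc, Set.mem_Icc] at h1 h2 <;> grind

/-! ### One step of the chain -/

theorem hasSum_interlace_alt (hq : 0 < q) (hq1 : q < 1) (hm : ζm < 0) (hp : 0 < ζp)
    {φ : ℕ → ℝ → ℝ} (hφ : ∀ j, LocBdd (φ j)) {N : ℕ} (X : Level q ζm ζp (N + 1)) :
    HasSum (fun Y : Level q ζm ζp N => open Classical in
      if Interlace q ζm ζp Y X then (∏ i, |Y.pt i|) * alt φ Y.pt else 0)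
      (alt (qLift q φ) X.pt) := by
  classical
  set I : Fin N → Set ℝ := fun i => qInterval q ζm ζp (X.pt i.castSucc) (X.pt i.succ) with hI
  have h1 : HasSum (fun y : Fin N → ℝ => if ∀ i, y i ∈ I i then (∏ i, |y i|) * alt φ y else 0)
      (alt (qLift q φ) X.pt) := by
    rw [alt_qLift, Matrix.det_apply]
    have h2 : ∀ σ : Equiv.Perm (Fin N), HasSum (fun y : Fin N → ℝ =>
        Equiv.Perm.sign σ • ∏ i, (I (σ i)).indicator (fun t => |t| * φ i t) (y (σ i)))
        (Equiv.Perm.sign σ • ∏ i, (Matrix.of fun i j : Fin N =>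
          qInt q (φ j) (X.pt i.succ) - qInt q (φ j) (X.pt i.castSucc)) (σ i) i) := by
      intro σ
      -- The factors are indexed by the row i, with column `σ.symm i`, so that the coordinate y_i
      -- goes with its own interval; afterwards the product is reindexed by columns.
      have h3 := (summable_norm_and_hasSum_prod fun i : Fin N =>
        hasSum_qInterval hq hq1 hm hp (hφ (σ.symm i : Fin N)) (X.pt_mem_qLattice i.castSucc)
          (X.pt_mem_qLattice i.succ) (X.pt_strictMono Fin.castSucc_lt_succ)).2
      rw [← Equiv.prod_comp σ] at h3
      refine HasSum.const_smul _ ?_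
      simp only [Equiv.symm_apply_apply] at h3
      refine h3.congr_fun fun y => ?_
      refine Eq.trans ?_ (Equiv.prod_comp σ _)
      simp only [Equiv.symm_apply_apply, hI]
    refine (hasSum_sum fun σ _ => h2 σ).congr_fun fun y => ?_
    split_ifs with hy
    · rw [alt, Matrix.det_apply, Finset.mul_sum]
      refine Finset.sum_congr rfl fun σ _ => ?_
      rw [mul_smul_comm, ← Equiv.prod_comp σ, ← Finset.prod_mul_distrib]
      congr 1
      refine Finset.prod_congr rfl fun i _ => ?_
      rw [Set.indicator_of_mem (hy _)]
      rfl
    · push Not at hy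
      obtain ⟨i, hi⟩ := hy
      symm
      refine Finset.sum_eq_zero fun σ _ => ?_
      rw [Finset.prod_eq_zero (Finset.mem_univ (σ.symm i)), smul_zero]
      rw [Equiv.apply_symm_apply, Set.indicator_of_notMem hi]
  rw [← (Level.pt_injective N).hasSum_iff] at h1
  · refine h1.congr_fun fun Y => ?_
    simp only [Interlace, hI, Function.comp_apply]
    congr
  · intro y hy
    rw [if_neg]
    intro h
    exact hy (exists_level_pt_eq (strictMono_of_mem_qInterval X.pt_strictMono
      (fun i => ne_zero_of_mem_qLattice hq hm hp (X.pt_mem_qLattice i)) h) fun i => (h i).2)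

/-- The products `(1 - q) ⋯ (1 - q ^ n)`. -/
def qFact (q : ℝ) (n : ℕ) : ℝ := ∏ i ∈ Finset.range n, (1 - q ^ (i + 1))

theorem qFact_pos (hq : 0 < q) (hq1 : q < 1) (n : ℕ) : 0 < qFact q n :=
  Finset.prod_pos fun i _ => sub_pos.2 (pow_lt_one₀ hq.le hq1 i.succ_ne_zero)

theorem qFact_succ (n : ℕ) : qFact q (n + 1) = qFact q n * (1 - q ^ (n + 1)) :=
  Finset.prod_range_succ _ n

/-- The action of a link on the quotients of alternants. -/
theorem hasSum_cotransition_alt (hq : 0 < q) (hq1 : q < 1) (hm : ζm < 0) (hp : 0 < ζp)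
    {φ : ℕ → ℝ → ℝ} (hφ : ∀ j, LocBdd (φ j)) {N : ℕ} (X : Level q ζm ζp (N + 1)) :
    HasSum (fun Y : Level q ζm ζp N => cotransition q ζm ζp N X Y * (alt φ Y.pt / vdm Y.pt))
      (qFact q N * (alt (qLift q φ) X.pt / vdm X.pt)) := by
  rw [mul_div_left_comm]
  refine ((hasSum_interlace_alt hq hq1 hm hp hφ X).mul_right (qFact q N / vdm X.pt)).congr_fun
    fun Y => ?_
  have := (vdm_pt_pos Y).ne'
  have := (vdm_pt_pos X).ne'
  unfold cotransition
  split_ifs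
  · rw [qFact]
    field_simp
  · simp

/-- This fixed sequence is the source of stochasticity: its alternants are constant multiples of the
Vandermonde product. -/
theorem qLift_pow (hq : 0 < q) (hq1 : q < 1) :
    qLift q (fun j x => (qFact q j)⁻¹ * x ^ j) = fun j x => (qFact q j)⁻¹ * x ^ j := by
  funext j x
  cases j with
  | zero => simp [qLift, qFact]
  | succ j =>
    rw [qLift, qInt_pow hq hq1, qFact_succ, mul_inv]

theorem LocBdd.const_mul_pow (c : ℝ) (m : ℕ) : LocBdd fun x => c * x ^ m := fun R =>
  ⟨|c| * R ^ m, fun x hx => by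
    rw [abs_mul, abs_pow]
    gcongr⟩

/-- The rows of a link sum up to one. -/
theorem hasSum_cotransition (hq : 0 < q) (hq1 : q < 1) (hm : ζm < 0) (hp : 0 < ζp) {N : ℕ}
    (X : Level q ζm ζp (N + 1)) : HasSum (cotransition q ζm ζp N X) 1 := by
  have h := hasSum_cotransition_alt hq hq1 hm hp (φ := fun j x => (qFact q j)⁻¹ * x ^ j)
    (fun j => LocBdd.const_mul_pow _ j) X
  rw [qLift_pow hq hq1] at h
  simp only [alt_vandermonde, mul_div_cancel_right₀ _ (vdm_pt_pos _).ne'] at h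
  -- The constants at the two levels differ by the single factor 1/`qFact q N`, which the factor of
  -- the link cancels.
  rw [Finset.prod_range_succ] at h
  have h0 : (∏ j ∈ Finset.range N, (qFact q j)⁻¹) ≠ 0 :=
    Finset.prod_ne_zero_iff.2 fun j _ => (inv_pos.2 (qFact_pos hq hq1 j)).ne'
  have h1 := (qFact_pos hq hq1 N).ne'
  have h2 := h.mul_right (∏ j ∈ Finset.range N, (qFact q j)⁻¹)⁻¹
  rw [mul_left_comm, mul_inv_cancel₀ h1, mul_one, mul_inv_cancel₀ h0] at h2
  refine h2.congr_fun fun Y => ?_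
  rw [mul_assoc, mul_inv_cancel₀ h0, mul_one]

/-! ### Expansion of alternants -/

theorem alt_congr {φ ψ : ℕ → ℝ → ℝ} {n : ℕ} (h : ∀ j < n, φ j = ψ j) (x : Fin n → ℝ) :
    alt φ x = alt ψ x := by
  unfold alt
  congr 1
  ext i j
  simp [h j j.2]

/-- The last monomial may be replaced by the monic polynomial that vanishes at all points but x_i;
expansion along that column then has one nonzero term. -/
theorem vdm_eq_mul_succAbove {n : ℕ} (x : Fin (n + 1) → ℝ) (i : Fin (n + 1)) :
    vdm x = (-1) ^ (i + n : ℕ) * (∏ j : Fin n, (x i - x (i.succAbove j))) *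
      vdm (x ∘ i.succAbove) := by
  classical
  let p : Fin (n + 1) → Polynomial ℝ := Fin.snoc (fun j : Fin n => Polynomial.X ^ (j : ℕ))
    (∏ j : Fin n, (Polynomial.X - Polynomial.C (x (i.succAbove j))))
  have hdeg : ∀ j, (p j).natDegree = j := by
    refine Fin.lastCases ?_ fun j => ?_
    · simp only [p, Fin.snoc_last, Fin.val_last]
      rw [Polynomial.natDegree_prod_of_monic _ _ fun j _ => Polynomial.monic_X_sub_C _]
      simp
    · simp [p]
  have hmonic : ∀ j, (p j).Monic := by
    refine Fin.lastCases ?_ fun j => ?_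
    · simp only [p, Fin.snoc_last]
      exact Polynomial.monic_prod_of_monic _ _ fun j _ => Polynomial.monic_X_sub_C _
    · simp only [p, Fin.snoc_castSucc]
      exact Polynomial.monic_X_pow _
  rw [vdm, ← Matrix.det_vandermonde,
    Matrix.det_eval_matrixOfPolynomials_eq_det_vandermonde x p hdeg hmonic,
    Matrix.det_succ_column _ (Fin.last n), Finset.sum_eq_single i]
  · rw [vdm, ← Matrix.det_vandermonde]
    congr 1
    · simp [p, Polynomial.eval_prod]
    · congr 1
      ext k l
      simp [p, Matrix.vandermonde]
  · intro k _ hk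
    obtain ⟨j, rfl⟩ := Fin.exists_succAbove_eq hk
    have : (p (Fin.last n)).eval (x (i.succAbove j)) = 0 := by
      simp only [p, Fin.snoc_last, Polynomial.eval_prod]
      exact Finset.prod_eq_zero (Finset.mem_univ j) (by simp)
    simp [this]
  · simp

theorem vdm_ne_zero {n : ℕ} {x : Fin n → ℝ} (hx : Function.Injective x) : vdm x ≠ 0 := by
  rw [vdm, ← Matrix.det_vandermonde]
  exact Matrix.det_vandermonde_ne_zero_iff.2 hx

/-- Expansion of a quotient of alternants along the last function. -/
theorem alt_div_vdm_succ (φ : ℕ → ℝ → ℝ) {n : ℕ} {x : Fin (n + 1) → ℝ}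
    (hx : Function.Injective x) :
    alt φ x / vdm x = ∑ i, φ n (x i) / (∏ j : Fin n, (x i - x (i.succAbove j))) *
      (alt φ (x ∘ i.succAbove) / vdm (x ∘ i.succAbove)) := by
  rw [alt, Matrix.det_succ_column _ (Fin.last n), Finset.sum_div]
  refine Finset.sum_congr rfl fun i _ => ?_
  have h1 : vdm (x ∘ i.succAbove) ≠ 0 := vdm_ne_zero (hx.comp Fin.succAbove_right_injective)
  have h2 : (∏ j : Fin n, (x i - x (i.succAbove j))) ≠ 0 := by
    refine Finset.prod_ne_zero_iff.2 fun j _ => sub_ne_zero.2 fun h => ?_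
    exact Fin.succAbove_ne i j (hx h).symm
  have h3 : ((-1 : ℝ) ^ (i + n : ℕ)) ≠ 0 := pow_ne_zero _ (by norm_num)
  have h4 : ((Matrix.of fun i j : Fin (n + 1) => φ j (x i)).submatrix i.succAbove
      (Fin.last n).succAbove).det = alt φ (x ∘ i.succAbove) := by
    unfold alt
    congr 1
    ext k l
    simp
  rw [h4, vdm_eq_mul_succAbove x i]
  simp only [Matrix.of_apply, Fin.val_last]
  field_simp

/-- The product of `1 - x / a` over the points `x ≠ a` of a configuration. -/
def coprod (X : Set ℝ) (a : ℝ) : ℝ := ∏' x : ℝ, (1 + (X \ {a}).indicator (fun x => -(x / a)) x)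

theorem coprod_finset (X : Finset ℝ) (a : ℝ) :
    coprod (X : Set ℝ) a = ∏ x ∈ X.erase a, (1 - x / a) := by
  rw [coprod, tprod_eq_prod (s := X.erase a)]
  · refine Finset.prod_congr rfl fun x hx => ?_
    rw [Set.indicator_of_mem (by simpa [and_comm] using hx), sub_eq_add_neg]
  · intro x hx
    rw [Set.indicator_of_notMem (by simpa [and_comm] using hx), add_zero]

/-- The iterated sum over the points of a configuration which arises from the expansion of a
quotient of alternants along the last `K` functions. -/
def peelSum (g : ℕ → ℝ → ℝ) : ℕ → Set ℝ → ℝ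
  | 0, _ => 1
  | K + 1, X => ∑' a : ℝ, X.indicator
      (fun a => g K a * (a ^ K)⁻¹ * (coprod X a)⁻¹ * peelSum g K (X \ {a})) a

theorem peelSum_range (g : ℕ → ℝ → ℝ) (K : ℕ) {n : ℕ} {x : Fin (n + 1) → ℝ}
    (hx : Function.Injective x) :
    peelSum g (K + 1) (Set.range x) = ∑ i, g K (x i) * (x i ^ K)⁻¹ *
      (∏ j : Fin n, (1 - x (i.succAbove j) / x i))⁻¹ *
        peelSum g K (Set.range (x ∘ i.succAbove)) := by
  classical
  have hr : Set.range x = ((Finset.univ.image x : Finset ℝ) : Set ℝ) := by simp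
  rw [peelSum, tsum_eq_sum (s := Finset.univ.image x), Finset.sum_image hx.injOn]
  · refine Finset.sum_congr rfl fun i _ => ?_
    rw [Set.indicator_of_mem (Set.mem_range_self i)]
    have h1 : Set.range x \ {x i} = Set.range (x ∘ i.succAbove) := by
      rw [Set.range_comp, Fin.range_succAbove, Set.image_compl_eq_range_sdiff_image hx,
        Set.image_singleton]
    have h2 : (Finset.univ.image x).erase (x i) = Finset.univ.image (x ∘ i.succAbove) := by
      rw [← Finset.coe_inj]
      simpa [Function.comp_def] using h1
    rw [h1, hr, coprod_finset, h2,
      Finset.prod_image (hx.comp Fin.succAbove_right_injective).injOn]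
    rfl
  · intro a ha
    rw [Set.indicator_of_notMem]
    simpa using ha

theorem iterate_qLift_of_lt (hq : 0 < q) (hq1 : q < 1) (φ : ℕ → ℝ → ℝ) {d j : ℕ} (h : j < d) :
    (qLift q)^[d] φ j = fun x => (qFact q j)⁻¹ * x ^ j := by
  induction d generalizing j with
  | zero => omega
  | succ d ih =>
    rw [Function.iterate_succ_apply', ← congrFun (qLift_pow hq hq1) j]
    cases j with
    | zero => rfl
    | succ j => rw [qLift, qLift, ih (by omega)]

theorem iterate_qLift_add (φ : ℕ → ℝ → ℝ) (d j : ℕ) :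
    (qLift q)^[d] φ (d + j) = (qInt q)^[d] (φ j) := by
  induction d with
  | zero => simp
  | succ d ih =>
    rw [Function.iterate_succ_apply', Function.iterate_succ_apply', Nat.add_right_comm, qLift, ih]

/-- Each expansion along the last column uses up one of the functions that depend on φ. The power of
x_i pulled out of ∏(x_i - x_j) is split as x_i^d, which normalizes the d-fold integral, times x_i^K,
which stays in `peelSum`. The d remaining monomials contribute only a constant. -/
theorem alt_iterate_div_vdm (hq : 0 < q) (hq1 : q < 1) (φ : ℕ → ℝ → ℝ) (d K : ℕ) {N : ℕ}
    (hN : N = d + K) {x : Fin N → ℝ} (hx : Function.Injective x) (hx0 : ∀ i, x i ≠ 0) :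
    alt ((qLift q)^[d] φ) x / vdm x = (∏ j ∈ Finset.range d, (qFact q j)⁻¹) *
      peelSum (fun k a => (qInt q)^[d] (φ k) a / a ^ d) K (Set.range x) := by
  induction K generalizing N with
  | zero =>
    subst hN
    rw [alt_congr fun j hj => iterate_qLift_of_lt hq hq1 φ hj, alt_vandermonde,
      mul_div_cancel_right₀ _ (vdm_ne_zero hx), peelSum, mul_one]
  | succ K ih =>
    obtain rfl : N = d + K + 1 := hN
    rw [alt_div_vdm_succ _ hx, peelSum_range _ _ hx, Finset.mul_sum]
    refine Finset.sum_congr rfl fun i _ => ?_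
    rw [ih rfl (hx.comp Fin.succAbove_right_injective) fun j => hx0 _, iterate_qLift_add]
    have h : (∏ j : Fin (d + K), (x i - x (i.succAbove j))) =
        x i ^ d * x i ^ K * ∏ j : Fin (d + K), (1 - x (i.succAbove j) / x i) := by
      have h1 : ∀ j : Fin (d + K), x i - x (i.succAbove j) =
          x i * (1 - x (i.succAbove j) / x i) := fun j => by
        have := hx0 i
        field_simp
      rw [Finset.prod_congr rfl fun j _ => h1 j, Finset.prod_mul_distrib, Finset.prod_const,
        Finset.card_fin, pow_add]
    rw [h, div_eq_mul_inv, mul_inv, mul_inv, div_eq_mul_inv]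
    ring

/-! ### The composite links -/

/-- The indicator functions of the points of a configuration. -/
def dirac {M : ℕ} (Y : Level q ζm ζp M) (j : ℕ) (t : ℝ) : ℝ :=
  open Classical in if h : j < M then if t = Y.pt ⟨j, h⟩ then 1 else 0 else 0

/-- If X ≠ Y, equal cardinalities leave some point of Y outside X, and its column vanishes. -/
theorem alt_dirac {M : ℕ} (X Y : Level q ζm ζp M) :
    alt (dirac Y) X.pt = open Classical in if X = Y then 1 else 0 := by
  classical
  split_ifs with h
  · subst h
    rw [alt, ← Matrix.det_one (n := Fin M)]
    congr 1
    ext i j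
    simp [dirac, Matrix.one_apply, (Level.pt_strictMono X).injective.eq_iff]
  · have : ∃ j, Y.pt j ∉ X.1 := by
      by_contra! hj
      refine h (Subtype.ext (Finset.eq_of_subset_of_card_le ?_ ?_).symm)
      · intro y hy
        have : y ∈ Set.range Y.pt := by rw [Y.range_pt]; exact hy
        obtain ⟨j, rfl⟩ := this
        exact hj j
      · rw [X.2.2, Y.2.2]
    obtain ⟨j, hj⟩ := this
    refine Matrix.det_eq_zero_of_column_eq_zero j fun i => ?_
    simp only [Matrix.of_apply, dirac, Fin.is_lt, dif_pos, Fin.eta, ite_eq_right_iff,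
      one_ne_zero, imp_false]
    intro h'
    exact hj (h' ▸ X.pt_mem i)

theorem LocBdd.dirac {M : ℕ} (Y : Level q ζm ζp M) (j : ℕ) : LocBdd (dirac Y j) := by
  refine fun _ => ⟨1, fun x _ => ?_⟩
  unfold ExtGT.dirac
  split_ifs <;> simp

theorem LocBdd.iterate_qInt (hq : 0 < q) (hq1 : q < 1) {f : ℝ → ℝ} (hf : LocBdd f) (d : ℕ) :
    LocBdd ((ExtGT.qInt q)^[d] f) := by
  induction d with
  | zero => exact hf
  | succ d ih => rw [Function.iterate_succ_apply']; exact ih.qInt hq hq1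

theorem LocBdd.iterate_qLift (hq : 0 < q) (hq1 : q < 1) {φ : ℕ → ℝ → ℝ} (hφ : ∀ j, LocBdd (φ j))
    (d j : ℕ) : LocBdd ((ExtGT.qLift q)^[d] φ j) := by
  induction d generalizing j with
  | zero => exact hφ j
  | succ d ih => rw [Function.iterate_succ_apply']; exact LocBdd.qLift hq hq1 ih j

/-- The entries of the composite links as real numbers. -/
def compReal (K d : ℕ) (X : GSpace q ζm ζp (K + d)) (Y : GSpace q ζm ζp K) : ℝ :=
  (∏ e ∈ Finset.range d, qFact q (K + e + 1)) * vdm Y.pt *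
    (alt ((qLift q)^[d] (dirac Y)) X.pt / vdm X.pt)

/-- Nonnegativity is not visible in the determinant. It follows from the recursion through
nonnegative links, and is proved together with the identity because passing to `ENNReal` requires
it. -/
theorem compReal_nonneg_and_compLink_eq (hq : 0 < q) (hq1 : q < 1) (hm : ζm < 0) (hp : 0 < ζp)
    (K d : ℕ) (X : GSpace q ζm ζp (K + d)) (Y : GSpace q ζm ζp K) :
    0 ≤ compReal K d X Y ∧ compLink (Ω := GSpace q ζm ζp) (qLink q ζm ζp) K d X Y =
      ENNReal.ofReal (compReal K d X Y) := by
  classical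
  induction d with
  | zero =>
    have h : compReal K 0 X Y = if X = Y then 1 else 0 := by
      rw [compReal, Function.iterate_zero_apply, alt_dirac]
      split_ifs with h
      · subst h
        have := (vdm_pt_pos X).ne'
        simp
        field_simp
      · simp
    rw [h, compLink]
    split_ifs with h1 <;> simp [h1]
  | succ d ih =>
    have h1 : HasSum (fun Z : Level q ζm ζp (K + d + 1) =>
        cotransition q ζm ζp (K + d + 1) X Z * compReal K d Z Y) (compReal K (d + 1) X Y) := by
      have h := (hasSum_cotransition_alt (N := K + d + 1) hq hq1 hm hp
        (LocBdd.iterate_qLift hq hq1 (LocBdd.dirac Y) d) X).mul_left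
        ((∏ e ∈ Finset.range d, qFact q (K + e + 1)) * vdm Y.pt)
      have hc : ∀ a b c e : ℝ, a * b * c * e = a * c * (b * e) := fun a b c e => by ring
      rw [compReal, Finset.prod_range_succ, Function.iterate_succ_apply', hc]
      exact h.congr_fun fun Z => mul_left_comm _ _ _
    have h2 : ∀ Z : Level q ζm ζp (K + d + 1),
        0 ≤ cotransition q ζm ζp (K + d + 1) X Z * compReal K d Z Y := fun Z =>
      mul_nonneg (cotransition_nonneg q ζm ζp hq hq1 _ _ _) (ih Z).1
    refine ⟨h1.nonneg h2, ?_⟩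
    rw [← h1.tsum_eq, ENNReal.ofReal_tsum_of_nonneg h2 h1.summable, compLink]
    refine tsum_congr fun Z => ?_
    rw [ENNReal.ofReal_mul (cotransition_nonneg q ζm ζp hq hq1 _ _ _), (ih Z).2]
    rfl

/-- The rows of the composite links sum up to one. -/
theorem tsum_compLink (hq : 0 < q) (hq1 : q < 1) (hm : ζm < 0) (hp : 0 < ζp)
    (K d : ℕ) (X : GSpace q ζm ζp (K + d)) :
    ∑' Y, compLink (Ω := GSpace q ζm ζp) (qLink q ζm ζp) K d X Y = 1 := by
  classical
  induction d with
  | zero => simp only [compLink]; rw [tsum_ite_eq' X]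
  | succ d ih =>
    simp only [compLink]
    rw [ENNReal.tsum_comm]
    simp only [ENNReal.tsum_mul_left, ih, mul_one, qLink]
    have h := hasSum_cotransition (N := K + d + 1) hq hq1 hm hp X
    have h1 := ENNReal.ofReal_tsum_of_nonneg
      (cotransition_nonneg q ζm ζp hq hq1 (K + d + 1) X) h.summable
    rw [h.tsum_eq, ENNReal.ofReal_one] at h1
    exact h1.symm

/-! ### Sums over the lattice -/

/-- Listed in decreasing order, the values decay at least as fast as R, Rq, Rq², …. -/
theorem sum_le_of_separated (hq : 0 < q) (hq1 : q < 1) (s : Finset ℝ) (f : ℝ → ℝ)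
    (hsep : ∀ x ∈ s, ∀ y ∈ s, x ≠ y → f x ≤ f y → f x ≤ q * f y) (hf : ∀ x ∈ s, 0 ≤ f x) {R : ℝ}
    (hR0 : 0 ≤ R) (hR : ∀ x ∈ s, f x ≤ R) : ∑ x ∈ s, f x ≤ R * (1 - q)⁻¹ := by
  have h1 : 0 < 1 - q := sub_pos.2 hq1
  induction s using Finset.induction_on_max_value f generalizing R with
  | empty => simp only [Finset.sum_empty]; positivity
  | insert a s ha hmax ih =>
    have hfa := hf a (Finset.mem_insert_self a s)
    have h2 := ih (fun x hx y hy => hsep x (Finset.mem_insert_of_mem hx) y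
      (Finset.mem_insert_of_mem hy)) (fun x hx => hf x (Finset.mem_insert_of_mem hx))
      (mul_nonneg hq.le hfa) fun x hx => hsep x (Finset.mem_insert_of_mem hx) a
        (Finset.mem_insert_self a s) (fun h => ha (h ▸ hx)) (hmax x hx)
    have h3 := hR a (Finset.mem_insert_self a s)
    rw [Finset.sum_insert ha]
    calc f a + ∑ x ∈ s, f x ≤ f a + q * f a * (1 - q)⁻¹ := by gcongr
      _ = f a * (1 - q)⁻¹ := by field_simp; ring
      _ ≤ R * (1 - q)⁻¹ := by gcongr

/-- The sum of a function over a subset of the lattice is controlled by its maximum as soon as it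
is geometrically separated on both halves of the lattice. -/
theorem sum_lattice_le (hq : 0 < q) (hq1 : q < 1) (hm : ζm < 0) (hp : 0 < ζp) {s : Finset ℝ}
    (hs : ∀ x ∈ s, x ∈ qLattice q ζm ζp) (f : ℝ → ℝ)
    (hsep : ∀ x ∈ s, ∀ y ∈ s, 0 < x * y → x ≠ y → f x ≤ f y → f x ≤ q * f y)
    (hf : ∀ x ∈ s, 0 ≤ f x) {R : ℝ} (hR0 : 0 ≤ R) (hR : ∀ x ∈ s, f x ≤ R) :
    ∑ x ∈ s, f x ≤ 2 * R * (1 - q)⁻¹ := by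
  rw [← Finset.sum_filter_add_sum_filter_not s (fun x => 0 < x)]
  have h1 := sum_le_of_separated hq hq1 (s.filter fun x => 0 < x) f
    (fun x hx y hy => by
      rw [Finset.mem_filter] at hx hy
      exact hsep x hx.1 y hy.1 (mul_pos hx.2 hy.2))
    (fun x hx => hf x (Finset.mem_filter.1 hx).1) hR0
    fun x hx => hR x (Finset.mem_filter.1 hx).1
  have h0 : ∀ x ∈ s.filter fun x => ¬0 < x, x < 0 := fun x hx =>
    lt_of_le_of_ne (not_lt.1 (Finset.mem_filter.1 hx).2)
      (ne_zero_of_mem_qLattice hq hm hp (hs x (Finset.mem_filter.1 hx).1))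
  have h2 := sum_le_of_separated hq hq1 (s.filter fun x => ¬0 < x) f
    (fun x hx y hy => hsep x (Finset.mem_filter.1 hx).1 y (Finset.mem_filter.1 hy).1
      (mul_pos_of_neg_of_neg (h0 x hx) (h0 y hy)))
    (fun x hx => hf x (Finset.mem_filter.1 hx).1) hR0
    fun x hx => hR x (Finset.mem_filter.1 hx).1
  linarith

theorem abs_le_mul_of_ne (hq : 0 < q) (hq1 : q < 1) (hm : ζm < 0) (hp : 0 < ζp) {x y : ℝ}
    (hx : x ∈ qLattice q ζm ζp) (hy : y ∈ qLattice q ζm ζp) (hxy : 0 < x * y) (hne : x ≠ y)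
    (h : |x| ≤ |y|) : |x| ≤ q * |y| := by
  refine abs_le_mul_of_abs_lt hq hq1 hm hp hx hy hxy (lt_of_le_of_ne h fun h' => ?_)
  rcases abs_eq_abs.1 h' with h' | h'
  · exact hne h'
  · subst h'
    nlinarith [mul_self_nonneg y]

theorem sum_abs_div_le (hq : 0 < q) (hq1 : q < 1) (hm : ζm < 0) (hp : 0 < ζp) {s : Finset ℝ}
    (hs : ∀ x ∈ s, x ∈ qLattice q ζm ζp) {R : ℝ} (hR0 : 0 < R) (hR : ∀ x ∈ s, |x| ≤ R) :
    ∑ x ∈ s, |x| / R ≤ 2 * (1 - q)⁻¹ := by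
  have := sum_lattice_le hq hq1 hm hp hs (fun x => |x| / R)
    (fun x hx y hy hxy hne h => by
      rw [← mul_div_assoc]
      exact div_le_div_of_nonneg_right (abs_le_mul_of_ne hq hq1 hm hp (hs x hx) (hs y hy) hxy hne
        ((div_le_div_iff_of_pos_right hR0).1 h)) hR0.le)
    (fun x _ => by positivity) zero_le_one fun x hx => (div_le_one hR0).2 (hR x hx)
  simpa using this

theorem sum_div_abs_le (hq : 0 < q) (hq1 : q < 1) (hm : ζm < 0) (hp : 0 < ζp) {s : Finset ℝ}
    (hs : ∀ x ∈ s, x ∈ qLattice q ζm ζp) {R : ℝ} (hR0 : 0 < R) (hR : ∀ x ∈ s, R ≤ |x|) :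
    ∑ x ∈ s, R / |x| ≤ 2 * (1 - q)⁻¹ := by
  have hpos : ∀ x ∈ s, 0 < |x| := fun x hx => hR0.trans_le (hR x hx)
  have := sum_lattice_le hq hq1 hm hp hs (fun x => R / |x|)
    (fun x hx y hy hxy hne h => by
      have h1 := hpos x hx
      have h2 := hpos y hy
      have h3 : |y| ≤ |x| := (div_le_div_iff_of_pos_left hR0 h1 h2).1 h
      have h4 := abs_le_mul_of_ne hq hq1 hm hp (hs y hy) (hs x hx) (by rwa [mul_comm]) hne.symm h3
      rw [← mul_div_assoc, div_le_div_iff₀ h1 h2]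
      nlinarith)
    (fun x _ => by positivity) zero_le_one fun x hx => (div_le_one (hpos x hx)).2 (hR x hx)
  simpa using this

/-- The part of the lattice in the interval `[-R, R]`. -/
def window (q ζm ζp R : ℝ) : Set ℝ := {x ∈ qLattice q ζm ζp | |x| ≤ R}

theorem summable_window (hq : 0 < q) (hq1 : q < 1) (hm : ζm < 0) (hp : 0 < ζp) (R : ℝ) :
    Summable ((window q ζm ζp R).indicator fun x => |x|) := by
  classical
  refine summable_of_sum_le (c := 2 * (1 - q)⁻¹ * (|R| + 1))
    (fun x => Set.indicator_nonneg (fun x _ => abs_nonneg x) x) fun s => ?_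
  have hR : 0 < |R| + 1 := by positivity
  rw [Finset.sum_indicator_eq_sum_filter]
  have := sum_abs_div_le hq hq1 hm hp (s := s.filter fun x => x ∈ window q ζm ζp R)
    (fun x hx => (Finset.mem_filter.1 hx).2.1) hR fun x hx =>
      (Finset.mem_filter.1 hx).2.2.trans ((le_abs_self R).trans (by linarith))
  rw [← Finset.sum_div, div_le_iff₀ hR] at this
  exact this

/-! ### Products over configurations -/

theorem exp_neg_le_one_sub (hq1 : q < 1) {t : ℝ} (ht0 : 0 ≤ t) (ht : t ≤ q) :
    Real.exp (-(t * (1 - q)⁻¹)) ≤ 1 - t := by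
  have h1 : 0 < 1 - q := sub_pos.2 hq1
  have h2 : 0 < 1 - t := by linarith
  rw [← Real.le_log_iff_exp_le h2]
  refine le_trans ?_ (Real.one_sub_inv_le_log_of_pos h2)
  have h3 : 1 - (1 - t)⁻¹ = -(t * (1 - t)⁻¹) := by field_simp; ring
  rw [h3, neg_le_neg_iff]
  gcongr

/-- For t < 0 already 1 + |t| ≥ max(1, |t|). For t > 0 the lattice gap keeps t away from 1, and 1 -
s ≥ exp(-s/(1 - q)) is applied to s = t or s = 1/t. -/
theorem factor_lower_bound (hq : 0 < q) (hq1 : q < 1) {t : ℝ} (ht0 : t ≠ 0)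
    (ht : 0 < t → t ≤ q ∨ q⁻¹ ≤ t) :
    max 1 |t| * Real.exp (-(min |t| |t|⁻¹ * (1 - q)⁻¹)) ≤ |1 - t| := by
  have h1 : 0 < (1 - q)⁻¹ := inv_pos.2 (sub_pos.2 hq1)
  rcases lt_or_gt_of_ne ht0 with h | h
  · have h2 : 0 ≤ min |t| |t|⁻¹ := by positivity
    calc max 1 |t| * Real.exp (-(min |t| |t|⁻¹ * (1 - q)⁻¹)) ≤ max 1 |t| * 1 := by
          gcongr
          rw [Real.exp_le_one_iff]
          simp only [Left.neg_nonpos_iff]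
          positivity
      _ ≤ |1 - t| := by
          rw [mul_one, abs_of_neg h, abs_of_pos (by linarith)]
          exact max_le (by linarith) (by linarith)
  · rw [abs_of_pos h]
    rcases ht h with h2 | h2
    · have h3 : 1 ≤ t⁻¹ := (one_le_inv₀ h).2 (h2.trans hq1.le)
      rw [max_eq_left (h2.trans hq1.le), one_mul, min_eq_left ((h2.trans hq1.le).trans h3)]
      exact (exp_neg_le_one_sub hq1 h.le h2).trans (le_abs_self _)
    · have h3 : t⁻¹ ≤ q := inv_le_of_inv_le₀ hq h2
      have h4 : 1 ≤ t := ((one_le_inv₀ hq).2 hq1.le).trans h2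
      rw [max_eq_right h4, min_eq_right ((h3.trans hq1.le).trans h4)]
      calc t * Real.exp (-(t⁻¹ * (1 - q)⁻¹)) ≤ t * (1 - t⁻¹) := by
            gcongr
            exact exp_neg_le_one_sub hq1 (inv_nonneg.2 h.le) h3
        _ = t - 1 := by field_simp
        _ ≤ |1 - t| := by rw [abs_sub_comm]; exact le_abs_self _

/-- A lower bound for the coproducts, depending only on `q`. -/
def coprodBound (q : ℝ) : ℝ := Real.exp (-(4 * (1 - q)⁻¹ * (1 - q)⁻¹))

theorem coprodBound_pos : 0 < coprodBound q := Real.exp_pos _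

/-- The exponential losses of the factors add up to a bound independent of X and a, by summing
|x|/|a| over the smaller points and |a|/|x| over the larger ones. In addition each point of B
contributes a factor at least δ/|a|, so the product is large when a is near 0. -/
theorem coprod_lower_bound (hq : 0 < q) (hq1 : q < 1) (hm : ζm < 0) (hp : 0 < ζp) {X B : Finset ℝ}
    (hX : ∀ x ∈ X, x ∈ qLattice q ζm ζp) {a δ : ℝ} (ha : a ∈ qLattice q ζm ζp) (hδ : 0 < δ)
    (hB : B ⊆ X.erase a) (hBδ : ∀ x ∈ B, δ ≤ |x|) :
    coprodBound q * (δ / |a|) ^ B.card ≤ |coprod (X : Set ℝ) a| := by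
  have ha0 : 0 < |a| := abs_pos.2 (ne_zero_of_mem_qLattice hq hm hp ha)
  have h1 : 0 < (1 - q)⁻¹ := inv_pos.2 (sub_pos.2 hq1)
  have hX' : ∀ x ∈ X.erase a, x ∈ qLattice q ζm ζp := fun x hx => hX x (Finset.mem_of_mem_erase hx)
  have habs : ∀ x : ℝ, |x / a| = |x| / |a| := fun x => abs_div x a
  rw [coprod_finset, Finset.abs_prod]
  have hfac : ∀ x ∈ X.erase a, max 1 (|x| / |a|) *
      Real.exp (-(min (|x| / |a|) (|a| / |x|) * (1 - q)⁻¹)) ≤ |1 - x / a| := by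
    intro x hx
    have hx0 := ne_zero_of_mem_qLattice hq hm hp (hX' x hx)
    have ha0' := ne_zero_of_mem_qLattice hq hm hp ha
    have := factor_lower_bound hq hq1 (div_ne_zero hx0 ha0') fun hpos => by
      have hxa : 0 < x * a := by
        rw [div_eq_mul_inv] at hpos
        have : x * a = x * a⁻¹ * (a * a) := by field_simp
        rw [this]
        exact mul_pos hpos (mul_self_pos.2 ha0')
      rw [← abs_of_pos hpos, habs]
      rcases le_total |x| |a| with h | h
      · left
        rw [div_le_iff₀ ha0]
        exact abs_le_mul_of_ne hq hq1 hm hp (hX' x hx) ha hxa (Finset.ne_of_mem_erase hx) h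
      · right
        rw [le_div_iff₀ ha0, inv_mul_le_iff₀ hq]
        exact abs_le_mul_of_ne hq hq1 hm hp ha (hX' x hx) (by rwa [mul_comm])
          (Finset.ne_of_mem_erase hx).symm h
    rwa [habs, inv_div] at this
  refine le_trans ?_ (Finset.prod_le_prod (fun x _ => by positivity) hfac)
  rw [Finset.prod_mul_distrib, mul_comm, ← Real.exp_sum]
  refine mul_le_mul ?_ ?_ (Real.exp_pos _).le (Finset.prod_nonneg fun x _ => by positivity)
  · rw [← Finset.prod_const]
    calc ∏ x ∈ B, δ / |a| ≤ ∏ x ∈ B, max 1 (|x| / |a|) := by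
          refine Finset.prod_le_prod (fun _ _ => by positivity) fun x hx => ?_
          refine le_max_of_le_right ?_
          gcongr
          exact hBδ x hx
      _ ≤ ∏ x ∈ X.erase a, max 1 (|x| / |a|) :=
          Finset.prod_le_prod_of_subset_of_one_le hB (fun _ _ => by positivity)
            fun _ _ _ => le_max_left _ _
  · rw [coprodBound, Real.exp_le_exp, Finset.sum_neg_distrib, neg_le_neg_iff, ← Finset.sum_mul]
    refine mul_le_mul_of_nonneg_right ?_ h1.le
    rw [← Finset.sum_filter_add_sum_filter_not (X.erase a) (fun x => |x| ≤ |a|)]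
    have h2 : ∑ x ∈ (X.erase a).filter (fun x => |x| ≤ |a|), min (|x| / |a|) (|a| / |x|) ≤
        2 * (1 - q)⁻¹ := (Finset.sum_le_sum fun x _ => min_le_left _ _).trans
      (sum_abs_div_le hq hq1 hm hp (fun x hx => hX' x (Finset.mem_filter.1 hx).1) ha0
        fun x hx => (Finset.mem_filter.1 hx).2)
    have h3 : ∑ x ∈ (X.erase a).filter (fun x => ¬|x| ≤ |a|), min (|x| / |a|) (|a| / |x|) ≤
        2 * (1 - q)⁻¹ := (Finset.sum_le_sum fun x _ => min_le_right _ _).trans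
      (sum_div_abs_le hq hq1 hm hp (fun x hx => hX' x (Finset.mem_filter.1 hx).1) ha0
        fun x hx => (not_le.1 (Finset.mem_filter.1 hx).2).le)
    linarith

/-- Pointwise convergence of configurations along a filter. -/
def ConvTo {ι : Type*} (l : Filter ι) (X : ι → Set ℝ) (Z : Set ℝ) : Prop :=
  ∀ x, ∀ᶠ i in l, (x ∈ X i ↔ x ∈ Z)

theorem ConvTo.sdiff {ι : Type*} {l : Filter ι} {X : ι → Set ℝ} {Z : Set ℝ} (h : ConvTo l X Z)
    (a : ℝ) : ConvTo l (fun i => X i \ {a}) (Z \ {a}) := fun x =>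
  (h x).mono fun i hi => by simp [hi]

theorem ConvTo.subset_window {ι : Type*} {l : Filter ι} [l.NeBot] {X : ι → Set ℝ} {Z W : Set ℝ}
    (h : ConvTo l X Z) (hX : ∀ᶠ i in l, X i ⊆ W) : Z ⊆ W := by
  intro x hx
  obtain ⟨i, hi, hi'⟩ := ((h x).and hX).exists
  exact hi' (hi.2 hx)

theorem tendsto_coprod (hq : 0 < q) (hq1 : q < 1) (hm : ζm < 0) (hp : 0 < ζp) {ι : Type*}
    {l : Filter ι} {X : ι → Set ℝ} {Z : Set ℝ} (h : ConvTo l X Z) {R : ℝ}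
    (hX : ∀ᶠ i in l, X i ⊆ window q ζm ζp R) (a : ℝ) :
    Tendsto (fun i => coprod (X i) a) l (𝓝 (coprod Z a)) := by
  refine tendsto_tprod_one_add_of_dominated_convergence
    ((summable_window hq hq1 hm hp R).mul_right |a|⁻¹) (fun x => ?_) ?_
  · refine tendsto_const_nhds.congr' ((h x).mono fun i hi => ?_)
    classical simp only [Set.indicator_apply, Set.mem_sdiff, hi]
  · filter_upwards [hX] with i hi x
    by_cases hx : x ∈ X i \ {a}
    · rw [Set.indicator_of_mem hx, Set.indicator_of_mem (hi hx.1), norm_neg, norm_div,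
        Real.norm_eq_abs, Real.norm_eq_abs, div_eq_mul_inv]
    · rw [Set.indicator_of_notMem hx, norm_zero]
      exact mul_nonneg (Set.indicator_nonneg (fun x _ => abs_nonneg x) x) (by positivity)

theorem abs_coprod_ge_of_tendsto (hq : 0 < q) (hq1 : q < 1) (hm : ζm < 0) (hp : 0 < ζp)
    {ι : Type*} {l : Filter ι} [l.NeBot] {X : ι → Set ℝ} {Z : Set ℝ} (h : ConvTo l X Z) {R : ℝ}
    (hX : ∀ᶠ i in l, X i ⊆ window q ζm ζp R) (hfin : ∀ᶠ i in l, (X i).Finite) {a : ℝ}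
    (ha : a ∈ qLattice q ζm ζp) : coprodBound q ≤ |coprod Z a| := by
  refine ge_of_tendsto (tendsto_coprod hq hq1 hm hp h hX a).abs ?_
  filter_upwards [hX, hfin] with i hi hi'
  -- With B empty the power of δ/|a| is 1, so the value of δ is irrelevant.
  have := coprod_lower_bound hq hq1 hm hp (X := hi'.toFinset) (B := ∅) (δ := 1)
    (fun x hx => (hi (hi'.mem_toFinset.1 hx)).1) ha one_pos (by simp) (by simp)
  simpa using this

/-! ### Convergence of the iterated sums -/

/-- `X` has at least `m` points outside of `(-δ, δ)`. -/
def HasLargePoints (X : Set ℝ) (δ : ℝ) (m : ℕ) : Prop :=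
  ∃ B : Finset ℝ, (B : Set ℝ) ⊆ X ∧ m ≤ B.card ∧ ∀ x ∈ B, δ ≤ |x|

theorem HasLargePoints.sdiff {X : Set ℝ} {δ : ℝ} {m : ℕ} (h : HasLargePoints X δ (m + 1)) (a : ℝ) :
    HasLargePoints (X \ {a}) δ m := by
  obtain ⟨B, hB, hm, hδ⟩ := h
  refine ⟨B.erase a, ?_, ?_, fun x hx => hδ x (Finset.mem_of_mem_erase hx)⟩
  · rw [Finset.coe_erase]
    exact Set.sdiff_subset_sdiff_left hB
  · have := Finset.pred_card_le_card_erase (s := B) (a := a)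
    omega

/-- Count of powers of |a|: u costs one and a^K costs K, while K + 2 large points other than a give
back K + 2. One power remains, and |a| is summable over the window. Removing a itself may cost one
more large point, hence K + 3. -/
theorem peelSum_term_bound (hq : 0 < q) (hq1 : q < 1) (hm : ζm < 0) (hp : 0 < ζp) {R δ : ℝ}
    (hδ : 0 < δ) (K : ℕ) {X : Set ℝ} (hfin : X.Finite) (hX : X ⊆ window q ζm ζp R)
    (hlarge : HasLargePoints X δ (K + 3)) {u b t M : ℝ} {a : ℝ} (ha : a ∈ X)
    (hu : |u| ≤ b / |a|) (ht : |t| ≤ M) :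
    |u * (a ^ K)⁻¹ * (coprod X a)⁻¹ * t| ≤
      |a| * (b * ((coprodBound q * δ ^ (K + 2))⁻¹ * M)) := by
  have ha0 : 0 < |a| := abs_pos.2 (ne_zero_of_mem_qLattice hq hm hp (hX ha).1)
  have hb : 0 ≤ b := by
    have := (abs_nonneg u).trans hu
    rwa [le_div_iff₀ ha0, zero_mul] at this
  obtain ⟨B, hB, hcard, hBδ⟩ := hlarge.sdiff a
  obtain ⟨B', hB', hcard'⟩ := Finset.exists_subset_card_eq hcard
  have hlow := coprod_lower_bound hq hq1 hm hp (X := hfin.toFinset) (B := B') (δ := δ)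
    (fun x hx => (hX (hfin.mem_toFinset.1 hx)).1) (hX ha).1 hδ
    (fun x hx => by
      have := hB (hB' hx)
      simpa [and_comm] using this) fun x hx => hBδ x (hB' hx)
  rw [hcard', hfin.coe_toFinset] at hlow
  have hc := coprodBound_pos (q := q)
  rw [abs_mul, abs_mul, abs_mul, abs_inv, abs_inv, abs_pow]
  calc |u| * (|a| ^ K)⁻¹ * |coprod X a|⁻¹ * |t|
      ≤ b / |a| * (|a| ^ K)⁻¹ * (coprodBound q * (δ / |a|) ^ (K + 2))⁻¹ * M := by gcongr
    _ = _ := by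
      rw [div_pow]
      field_simp
      ring

/-- The constant is uniform in X and g, and the b k are kept as a product, so that later they can
carry the dependence on Y and yield a majorant summable over Y. -/
theorem exists_peelSum_bound (hq : 0 < q) (hq1 : q < 1) (hm : ζm < 0) (hp : 0 < ζp) (R : ℝ) {δ : ℝ}
    (hδ : 0 < δ) (K : ℕ) : ∃ C, 0 ≤ C ∧ ∀ (X : Set ℝ), X.Finite → X ⊆ window q ζm ζp R →
      HasLargePoints X δ (K + 2) → ∀ (g : ℕ → ℝ → ℝ) (b : ℕ → ℝ), (∀ k < K, 0 ≤ b k) →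
      (∀ k < K, ∀ a ∈ window q ζm ζp R, |g k a| ≤ b k / |a|) →
      |peelSum g K X| ≤ C * ∏ k ∈ Finset.range K, b k := by
  induction K with
  | zero => exact ⟨1, zero_le_one, fun X _ _ _ g b _ _ => by simp [peelSum]⟩
  | succ K ih =>
    obtain ⟨C, hC, ih⟩ := ih
    have hs := summable_window hq hq1 hm hp R
    set S := ∑' x, (window q ζm ζp R).indicator (fun x => |x|) x with hS
    have hS0 : 0 ≤ S := tsum_nonneg fun x => Set.indicator_nonneg (fun x _ => abs_nonneg x) x
    have hc := coprodBound_pos (q := q)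
    refine ⟨S * ((coprodBound q * δ ^ (K + 2))⁻¹ * C), by positivity, ?_⟩
    intro X hfin hX hlarge g b hb hg
    have hbound : ∀ a, ‖X.indicator (fun a => g K a * (a ^ K)⁻¹ * (coprod X a)⁻¹ *
        peelSum g K (X \ {a})) a‖ ≤ (window q ζm ζp R).indicator (fun x => |x|) a *
        (b K * ((coprodBound q * δ ^ (K + 2))⁻¹ * (C * ∏ k ∈ Finset.range K, b k))) := by
      intro a
      have hbp : 0 ≤ ∏ k ∈ Finset.range K, b k :=
        Finset.prod_nonneg fun k hk => hb k (by have := Finset.mem_range.1 hk; omega)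
      have hbK := hb K K.lt_succ_self
      by_cases ha : a ∈ X
      · rw [Set.indicator_of_mem ha, Set.indicator_of_mem (hX ha), Real.norm_eq_abs]
        exact peelSum_term_bound hq hq1 hm hp hδ K hfin hX hlarge ha
          (hg K K.lt_succ_self a (hX ha))
          (ih _ (hfin.subset Set.sdiff_subset) (Set.sdiff_subset.trans hX) (hlarge.sdiff a) g b
            (fun k hk => hb k (by omega)) fun k hk => hg k (by omega))
      · rw [Set.indicator_of_notMem ha, norm_zero]
        exact mul_nonneg (Set.indicator_nonneg (fun x _ => abs_nonneg x) a) (by positivity)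
    refine (tsum_of_norm_bounded (hs.hasSum.mul_right _) hbound).trans (le_of_eq ?_)
    rw [Finset.prod_range_succ]
    ring

theorem tendsto_peelSum (hq : 0 < q) (hq1 : q < 1) (hm : ζm < 0) (hp : 0 < ζp) {ι : Type*}
    {l : Filter ι} [l.NeBot] {R δ : ℝ} (hδ : 0 < δ) (K : ℕ) {X : ι → Set ℝ} {Z : Set ℝ}
    (hconv : ConvTo l X Z) (hfin : ∀ᶠ i in l, (X i).Finite)
    (hX : ∀ᶠ i in l, X i ⊆ window q ζm ζp R)
    (hlarge : ∀ᶠ i in l, HasLargePoints (X i) δ (K + 2)) {g : ι → ℕ → ℝ → ℝ} {G : ℕ → ℝ → ℝ}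
    {b : ℕ → ℝ} (hb : ∀ k < K, 0 ≤ b k)
    (hg : ∀ᶠ i in l, ∀ k < K, ∀ a ∈ window q ζm ζp R, |g i k a| ≤ b k / |a|)
    (hG : ∀ k < K, ∀ a ∈ window q ζm ζp R, Tendsto (fun i => g i k a) l (𝓝 (G k a))) :
    Tendsto (fun i => peelSum (g i) K (X i)) l (𝓝 (peelSum G K Z)) := by
  induction K generalizing X Z with
  | zero => exact tendsto_const_nhds
  | succ K ih =>
    obtain ⟨C, hC, hCb⟩ := exists_peelSum_bound hq hq1 hm hp R hδ K
    have hc := coprodBound_pos (q := q)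
    refine tendsto_tsum_of_dominated_convergence
      (bound := fun a => (window q ζm ζp R).indicator (fun x => |x|) a *
        (b K * ((coprodBound q * δ ^ (K + 2))⁻¹ * (C * ∏ k ∈ Finset.range K, b k))))
      ((summable_window hq hq1 hm hp R).mul_right _) (fun a => ?_) ?_
    · by_cases ha : a ∈ Z
      · have haW := hconv.subset_window hX ha
        rw [Set.indicator_of_mem ha]
        have h1 : Tendsto (fun i => g i K a * (a ^ K)⁻¹ * (coprod (X i) a)⁻¹ *
            peelSum (g i) K (X i \ {a})) l
            (𝓝 (G K a * (a ^ K)⁻¹ * (coprod Z a)⁻¹ * peelSum G K (Z \ {a}))) := by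
          refine (((hG K K.lt_succ_self a haW).mul_const _).mul
            ((tendsto_coprod hq hq1 hm hp hconv hX a).inv₀ ?_)).mul
            (ih (hconv.sdiff a) (hfin.mono fun i hi => hi.subset Set.sdiff_subset)
              (hX.mono fun i hi => Set.sdiff_subset.trans hi)
              (hlarge.mono fun i hi => hi.sdiff a) (fun k hk => hb k (by omega))
              (hg.mono fun i hi k hk => hi k (by omega)) fun k hk => hG k (by omega))
          rw [← abs_pos]
          exact hc.trans_le (abs_coprod_ge_of_tendsto hq hq1 hm hp hconv hX hfin haW.1)
        refine h1.congr' ((hconv a).mono fun i hi => ?_)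
        beta_reduce
        rw [Set.indicator_of_mem (hi.2 ha)]
      · rw [Set.indicator_of_notMem ha]
        refine tendsto_const_nhds.congr' ((hconv a).mono fun i hi => ?_)
        beta_reduce
        rw [Set.indicator_of_notMem fun h => ha (hi.1 h)]
    · filter_upwards [hfin, hX, hlarge, hg] with i hfin hX hlarge hg a
      have hbp : 0 ≤ ∏ k ∈ Finset.range K, b k :=
        Finset.prod_nonneg fun k hk => hb k (by have := Finset.mem_range.1 hk; omega)
      have hbK := hb K K.lt_succ_self
      by_cases ha : a ∈ X i
      · rw [Set.indicator_of_mem ha, Set.indicator_of_mem (hX ha), Real.norm_eq_abs]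
        exact peelSum_term_bound hq hq1 hm hp hδ K hfin hX hlarge ha
          (hg K K.lt_succ_self a (hX ha))
          (hCb _ (hfin.subset Set.sdiff_subset) (Set.sdiff_subset.trans hX) (hlarge.sdiff a) _ b
            (fun k hk => hb k (by omega)) fun k hk => hg k (by omega))
      · rw [Set.indicator_of_notMem ha, norm_zero]
        exact mul_nonneg (Set.indicator_nonneg (fun x _ => abs_nonneg x) a) (by positivity)

/-! ### Iterated integrals of point indicators -/

/-- The indicator function of a point. -/
def delta (y t : ℝ) : ℝ := open Classical in if t = y then 1 else 0

theorem LocBdd.delta (y : ℝ) : LocBdd (delta y) := fun _ => ⟨1, fun x _ => by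
  unfold ExtGT.delta
  split_ifs <;> simp⟩

theorem dirac_eq_delta {M : ℕ} (Y : Level q ζm ζp M) (j : Fin M) : dirac Y j = delta (Y.pt j) := by
  funext t
  simp [dirac, delta]

theorem mem_orbit_of_mul_pow {x y : ℝ} {r : ℕ} (h : y ∈ orbit q (x * q ^ r)) : y ∈ orbit q x := by
  obtain ⟨s, rfl⟩ := h
  exact ⟨r + s, by simp [pow_add, mul_assoc]⟩

theorem iterate_qInt_delta_eq_zero {a y : ℝ} (h : y ∉ orbit q a) (d : ℕ) :
    (qInt q)^[d] (delta y) a = 0 := by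
  induction d generalizing a with
  | zero =>
    refine if_neg fun h' => h ⟨0, ?_⟩
    simpa using h'
  | succ d ih =>
    rw [Function.iterate_succ_apply', qInt, ← tsum_zero (β := ℕ)]
    refine tsum_congr fun r => ?_
    rw [ih fun h' => h (mem_orbit_of_mul_pow h'), mul_zero]

theorem qInt_delta (hq : 0 < q) (hq1 : q < 1) {a : ℝ} (ha : a ≠ 0) (y : ℝ) :
    qInt q (delta y) a = open Classical in if y ∈ orbit q a then y else 0 := by
  classical
  refine (hasSum_qInt hq hq1 (LocBdd.delta y) ha).unique ?_
  convert hasSum_single (f := (orbit q a).indicator fun t => t * delta y t) y ?_ using 1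
  · simp [Set.indicator_apply, delta]
  · intro t ht
    simp [Set.indicator_apply, delta, ht]

/-- The first integration already produces |y|; each further one acts as on a monomial, multiplying
the bound by |a|/(1 - q^(d+1)). -/
theorem abs_iterate_qInt_delta_le (hq : 0 < q) (hq1 : q < 1) {a : ℝ} (ha : a ≠ 0) (y : ℝ) (d : ℕ) :
    |(qInt q)^[d + 1] (delta y) a| ≤ |y| * |a| ^ d * (qFact q d)⁻¹ := by
  induction d generalizing a with
  | zero =>
    rw [zero_add, Function.iterate_one, qInt_delta hq hq1 ha]
    split_ifs <;> simp [qFact]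
  | succ d ih =>
    rw [Function.iterate_succ_apply', qInt]
    have h := hasSum_geometric_of_lt_one (pow_nonneg hq.le (d + 1))
      (pow_lt_one₀ hq.le hq1 d.succ_ne_zero)
    have hb : ∀ r : ℕ, ‖a * q ^ r * (qInt q)^[d + 1] (delta y) (a * q ^ r)‖ ≤
        |y| * |a| ^ (d + 1) * (qFact q d)⁻¹ * (q ^ (d + 1)) ^ r := by
      intro r
      rw [Real.norm_eq_abs, abs_mul, abs_mul, abs_pow, abs_of_pos hq]
      have h1 := ih (a := a * q ^ r) (mul_ne_zero ha (pow_pos hq r).ne')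
      rw [abs_mul, abs_pow, abs_of_pos hq] at h1
      calc |a| * q ^ r * |(qInt q)^[d + 1] (delta y) (a * q ^ r)|
          ≤ |a| * q ^ r * (|y| * (|a| * q ^ r) ^ d * (qFact q d)⁻¹) := by
            gcongr
        _ = _ := by ring
    refine (tsum_of_norm_bounded (h.mul_left (|y| * |a| ^ (d + 1) * (qFact q d)⁻¹)) hb).trans
      (le_of_eq ?_)
    rw [qFact_succ, mul_inv, mul_assoc]

/-- A lower bound for the products `(1 - q) ⋯ (1 - q ^ n)`. -/
def qFactBound (q : ℝ) : ℝ := Real.exp (-((1 - q)⁻¹ * (1 - q)⁻¹))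

theorem qFactBound_le (hq : 0 < q) (hq1 : q < 1) (n : ℕ) : qFactBound q ≤ qFact q n := by
  have h1 : 0 < 1 - q := sub_pos.2 hq1
  calc qFactBound q ≤ ∏ i ∈ Finset.range n, Real.exp (-(q ^ (i + 1) * (1 - q)⁻¹)) := by
        rw [← Real.exp_sum, qFactBound, Real.exp_le_exp, Finset.sum_neg_distrib, neg_le_neg_iff,
          ← Finset.sum_mul]
        refine mul_le_mul_of_nonneg_right ?_ (inv_pos.2 h1).le
        rw [← tsum_geometric_of_lt_one hq.le hq1]
        refine le_trans (Finset.sum_le_sum fun i _ => ?_)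
          ((summable_geometric_of_lt_one hq.le hq1).sum_le_tsum (Finset.range n)
            fun i _ => pow_nonneg hq.le i)
        exact pow_le_pow_of_le_one hq.le hq1.le i.le_succ
    _ ≤ qFact q n := Finset.prod_le_prod (fun i _ => (Real.exp_pos _).le) fun i _ =>
        exp_neg_le_one_sub hq1 (pow_nonneg hq.le _)
          (by simpa using pow_le_pow_of_le_one hq.le hq1.le (Nat.le_add_left 1 i))

/-- The normalized iterated integrals of the indicator of a point. -/
def deltaInt (q y : ℝ) (d : ℕ) (a : ℝ) : ℝ := (qInt q)^[d] (delta y) a / a ^ d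

theorem deltaInt_eq_zero {a y : ℝ} (h : y ∉ orbit q a) (d : ℕ) : deltaInt q y d a = 0 := by
  rw [deltaInt, iterate_qInt_delta_eq_zero h, zero_div]

theorem abs_deltaInt_le (hq : 0 < q) (hq1 : q < 1) {a : ℝ} (ha : a ≠ 0) (y : ℝ) {d : ℕ}
    (hd : d ≠ 0) : |deltaInt q y d a| ≤ |y| * (qFactBound q)⁻¹ / |a| := by
  obtain ⟨d, rfl⟩ := Nat.exists_eq_succ_of_ne_zero hd
  have ha' := abs_pos.2 ha
  have hb : 0 < qFactBound q := Real.exp_pos _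
  rw [deltaInt, abs_div, abs_pow, div_le_div_iff₀ (pow_pos ha' _) ha']
  calc |(qInt q)^[d + 1] (delta y) a| * |a| ≤ |y| * |a| ^ d * (qFact q d)⁻¹ * |a| := by
        gcongr
        exact abs_iterate_qInt_delta_le hq hq1 ha y d
    _ ≤ |y| * |a| ^ d * (qFactBound q)⁻¹ * |a| := by
        gcongr
        exact qFactBound_le hq hq1 d
    _ = _ := by rw [Nat.succ_eq_add_one]; ring

/-- This is the functional equation of the Jackson integral divided by a^(d+1). The increment
carries q^(d+1), so the sequence in d is Cauchy once the values at a q are bounded. -/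
theorem deltaInt_succ (hq : 0 < q) (hq1 : q < 1) {a : ℝ} (ha : a ≠ 0) (y : ℝ) (d : ℕ) :
    deltaInt q y (d + 1) a = deltaInt q y d a + q ^ (d + 1) * deltaInt q y (d + 1) (a * q) := by
  have := hq.ne'
  simp only [deltaInt]
  rw [Function.iterate_succ_apply', qInt_eq_add hq hq1 ((LocBdd.delta y).iterate_qInt hq hq1 d)]
  field_simp
  ring

theorem notMem_orbit_mul_self (hq : 0 < q) (hq1 : q < 1) {a : ℝ} (ha : a ≠ 0) :
    a ∉ orbit q (a * q) := by
  rintro ⟨r, hr⟩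
  have h1 : a * q ^ (r + 1) = a * q ^ 0 := by
    rw [pow_zero, mul_one, pow_succ']
    simpa [mul_assoc] using hr
  exact absurd (injective_orbit hq hq1 ha h1) r.succ_ne_zero

theorem deltaInt_self (hq : 0 < q) (hq1 : q < 1) {a : ℝ} (ha : a ≠ 0) (d : ℕ) :
    deltaInt q a d a = 1 := by
  induction d with
  | zero => simp [deltaInt, delta]
  | succ d ih =>
    rw [deltaInt_succ hq hq1 ha, ih, deltaInt_eq_zero (notMem_orbit_mul_self hq hq1 ha), mul_zero,
      add_zero]

theorem exists_tendsto_deltaInt (hq : 0 < q) (hq1 : q < 1) {a : ℝ} (ha : a ≠ 0) (y : ℝ) :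
    ∃ L, Tendsto (fun d => deltaInt q y d a) atTop (𝓝 L) := by
  refine cauchySeq_tendsto_of_complete (cauchySeq_of_le_geometric q
    (|y| * (qFactBound q)⁻¹ / |a * q|) hq1 fun d => ?_)
  have haq : a * q ≠ 0 := mul_ne_zero ha hq.ne'
  rw [dist_comm, Real.dist_eq, deltaInt_succ hq hq1 ha, add_sub_cancel_left, abs_mul, abs_pow,
    abs_of_pos hq, mul_comm]
  have hb : 0 < qFactBound q := Real.exp_pos _
  refine mul_le_mul (abs_deltaInt_le hq hq1 haq y d.succ_ne_zero)
    (pow_le_pow_of_le_one hq.le hq1.le d.le_succ) (by positivity) (by positivity)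

/-- The limits of the normalized iterated integrals of the indicator of a point. -/
def deltaLim (q y a : ℝ) : ℝ := limUnder atTop fun d => deltaInt q y d a

theorem tendsto_deltaLim (hq : 0 < q) (hq1 : q < 1) {a : ℝ} (ha : a ≠ 0) (y : ℝ) :
    Tendsto (fun d => deltaInt q y d a) atTop (𝓝 (deltaLim q y a)) :=
  tendsto_nhds_limUnder (exists_tendsto_deltaInt hq hq1 ha y)

theorem deltaLim_self (hq : 0 < q) (hq1 : q < 1) {a : ℝ} (ha : a ≠ 0) : deltaLim q a a = 1 :=
  tendsto_nhds_unique (tendsto_deltaLim hq hq1 ha a)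
    (by simpa only [deltaInt_self hq hq1 ha] using tendsto_const_nhds)

theorem deltaLim_eq_zero (hq : 0 < q) (hq1 : q < 1) {a y : ℝ} (ha : a ≠ 0) (h : y ∉ orbit q a) :
    deltaLim q y a = 0 :=
  tendsto_nhds_unique (tendsto_deltaLim hq hq1 ha y)
    (by simpa only [deltaInt_eq_zero h] using tendsto_const_nhds)

/-! ### The normalizing constants -/

/-- The normalizing constants in the formula for the composite links. -/
def normConst (q : ℝ) (M d : ℕ) : ℝ :=
  ∏ e ∈ Finset.range d, (qFact q (M + e) / qFact q e)

theorem qFact_div_qFact_le_one (hq : 0 < q) (hq1 : q < 1) (M e : ℕ) :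
    qFact q (M + e) / qFact q e ≤ 1 := by
  rw [div_le_one (qFact_pos hq hq1 e), add_comm, qFact, Finset.prod_range_add]
  exact mul_le_of_le_one_right (qFact_pos hq hq1 e).le
    (Finset.prod_le_one (fun _ _ => sub_nonneg.2 (pow_le_one₀ hq.le hq1.le))
      fun _ _ => sub_le_self _ (pow_nonneg hq.le _))

theorem normConst_pos (hq : 0 < q) (hq1 : q < 1) (M d : ℕ) : 0 < normConst q M d :=
  Finset.prod_pos fun e _ => div_pos (qFact_pos hq hq1 _) (qFact_pos hq hq1 e)

theorem normConst_one (hq : 0 < q) (hq1 : q < 1) (d : ℕ) : normConst q 1 d = qFact q d := by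
  refine Finset.prod_congr rfl fun e _ => ?_
  rw [add_comm, qFact_succ, mul_div_cancel_left₀ _ (qFact_pos hq hq1 e).ne']

theorem normConst_antitone (hq : 0 < q) (hq1 : q < 1) (M : ℕ) : Antitone (normConst q M) :=
  antitone_nat_of_succ_le fun d => by
    rw [normConst, Finset.prod_range_succ]
    exact mul_le_of_le_one_right (normConst_pos hq hq1 M d).le (qFact_div_qFact_le_one hq hq1 M d)

theorem normConst_le_one (hq : 0 < q) (hq1 : q < 1) (M d : ℕ) : normConst q M d ≤ 1 :=
  (normConst_antitone hq hq1 M d.zero_le).trans_eq (by simp [normConst])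

theorem exists_tendsto_normConst (hq : 0 < q) (hq1 : q < 1) (M : ℕ) :
    ∃ L, Tendsto (normConst q M) atTop (𝓝 L) :=
  ⟨_, tendsto_atTop_ciInf (normConst_antitone hq hq1 M)
    ⟨0, by rintro _ ⟨d, rfl⟩; exact (normConst_pos hq hq1 M d).le⟩⟩

/-- The limits of the normalizing constants. -/
def normLim (q : ℝ) (M : ℕ) : ℝ := limUnder atTop (normConst q M)

theorem tendsto_normConst (hq : 0 < q) (hq1 : q < 1) (M : ℕ) :
    Tendsto (normConst q M) atTop (𝓝 (normLim q M)) :=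
  tendsto_nhds_limUnder (exists_tendsto_normConst hq hq1 M)

theorem normLim_one_pos (hq : 0 < q) (hq1 : q < 1) : 0 < normLim q 1 :=
  (Real.exp_pos _).trans_le (ge_of_tendsto' (tendsto_normConst hq hq1 1) fun d => by
    rw [normConst_one hq hq1]
    exact qFactBound_le hq hq1 d)

/-! ### The limits of the entries of the composite links -/

theorem peelSum_congr {g g' : ℕ → ℝ → ℝ} {K : ℕ} (h : ∀ k < K, g k = g' k) (X : Set ℝ) :
    peelSum g K X = peelSum g' K X := by
  induction K generalizing X with
  | zero => rfl
  | succ K ih =>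
    simp only [peelSum, h K K.lt_succ_self, ih fun k hk => h k (by omega)]

/-- The points of a configuration in increasing order, completed with zeros. -/
def Level.entry {M : ℕ} (Y : Level q ζm ζp M) (k : ℕ) : ℝ := if h : k < M then Y.pt ⟨k, h⟩ else 0

theorem Level.entry_fin {M : ℕ} (Y : Level q ζm ζp M) (k : Fin M) : Y.entry k = Y.pt k := by
  simp [Level.entry]

/-- The factors `qFact` of the links, divided by those from the monomials, form `normConst`. -/
theorem compReal_eq (hq : 0 < q) (hq1 : q < 1) (hm : ζm < 0) (hp : 0 < ζp)
    (K d : ℕ) (X : GSpace q ζm ζp (K + d)) (Y : GSpace q ζm ζp K) :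
    compReal K d X Y = normConst q (K + 1) d * vdm Y.pt *
      peelSum (fun k => deltaInt q (Y.entry k) d) (K + 1) (X.1 : Set ℝ) := by
  have h1 : peelSum (fun k => deltaInt q (Y.entry k) d) (K + 1) (X.1 : Set ℝ) =
      peelSum (fun k a => (qInt q)^[d] (dirac Y k) a / a ^ d) (K + 1) (X.1 : Set ℝ) := by
    refine peelSum_congr (fun k hk => ?_) _
    funext a
    rw [deltaInt, Y.entry_fin ⟨k, hk⟩, dirac_eq_delta Y ⟨k, hk⟩]
  rw [compReal, alt_iterate_div_vdm hq hq1 (dirac Y) d (K + 1) (by omega)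
    X.pt_strictMono.injective fun i => ne_zero_of_mem_qLattice hq hm hp (X.pt_mem_qLattice i),
    h1, normConst, Level.range_pt, Finset.prod_div_distrib, Finset.prod_inv_distrib]
  simp only [Nat.add_right_comm K _ 1]
  ring

/-- The limits of the entries of the composite links. -/
def limReal (K : ℕ) (Z : Set ℝ) (Y : GSpace q ζm ζp K) : ℝ :=
  normLim q (K + 1) * vdm Y.pt * peelSum (fun k => deltaLim q (Y.entry k)) (K + 1) Z

/-- The value vanishes unless y lies on the orbit of a, and then y is in the window too. So the
bound charges only configurations Y inside the window, which makes it summable over Y. -/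
theorem abs_deltaInt_le_window (hq : 0 < q) (hq1 : q < 1) (hm : ζm < 0) (hp : 0 < ζp) {R a y : ℝ}
    (ha : a ∈ window q ζm ζp R) {d : ℕ} (hd : d ≠ 0) :
    |deltaInt q y d a| ≤
      (window q ζm ζp R).indicator (fun x => |x|) y * (qFactBound q)⁻¹ / |a| := by
  have ha0 := ne_zero_of_mem_qLattice hq hm hp ha.1
  by_cases hy : y ∈ orbit q a
  · have h := (mem_orbit_iff hq hq1 hm hp ha.1).1 hy
    rw [Set.indicator_of_mem (show y ∈ window q ζm ζp R from ⟨h.1, h.2.2.trans ha.2⟩)]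
    exact abs_deltaInt_le hq hq1 ha0 y hd
  · rw [deltaInt_eq_zero hy, abs_zero]
    have : 0 ≤ (window q ζm ζp R).indicator (fun x => |x|) y :=
      Set.indicator_nonneg (fun x _ => abs_nonneg x) y
    have hb : 0 < qFactBound q := Real.exp_pos _
    positivity

/-- A general filter is allowed because the converse direction uses this along ultrafilters. -/
theorem tendsto_compReal (hq : 0 < q) (hq1 : q < 1) (hm : ζm < 0) (hp : 0 < ζp) {K : ℕ}
    {l : Filter ℕ} [l.NeBot] (hl : l ≤ atTop) {X : ∀ d, GSpace q ζm ζp (K + d)} {Z : Set ℝ}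
    (hconv : ConvTo l (fun d => ((X d).1 : Set ℝ)) Z) {R δ : ℝ} (hδ : 0 < δ)
    (hX : ∀ᶠ d in l, ((X d).1 : Set ℝ) ⊆ window q ζm ζp R)
    (hlarge : ∀ᶠ d in l, HasLargePoints ((X d).1 : Set ℝ) δ (K + 3)) (Y : GSpace q ζm ζp K) :
    Tendsto (fun d => compReal K d (X d) Y) l (𝓝 (limReal K Z Y)) := by
  simp only [compReal_eq hq hq1 hm hp]
  refine (((tendsto_normConst hq hq1 (K + 1)).mono_left hl).mul_const _).mul
    (tendsto_peelSum hq hq1 hm hp hδ (K + 1) hconv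
      (Eventually.of_forall fun d => Finset.finite_toSet _) hX hlarge
      (b := fun k => (window q ζm ζp R).indicator (fun x => |x|) (Y.entry k) * (qFactBound q)⁻¹)
      (fun k _ => mul_nonneg (Set.indicator_nonneg (fun x _ => abs_nonneg x) _)
        (inv_pos.2 (Real.exp_pos _)).le) ?_ fun k _ a ha =>
        (tendsto_deltaLim hq hq1 (ne_zero_of_mem_qLattice hq hm hp ha.1) _).mono_left hl)
  filter_upwards [hl (eventually_ne_atTop 0)] with d hd k _ a ha
  exact abs_deltaInt_le_window hq hq1 hm hp ha hd

theorem abs_vdm_le {M : ℕ} {y : Fin M → ℝ} {R : ℝ} (hy : ∀ i, |y i| ≤ R) :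
    |vdm y| ≤ ∏ i : Fin M, ∏ _j ∈ Finset.Ioi i, (R + R) := by
  simp only [vdm, Finset.abs_prod]
  refine Finset.prod_le_prod (fun _ _ => Finset.prod_nonneg fun _ _ => abs_nonneg _) fun i _ =>
    Finset.prod_le_prod (fun _ _ => abs_nonneg _) fun j _ =>
      (abs_sub _ _).trans (add_le_add (hy j) (hy i))

theorem exists_compReal_bound (hq : 0 < q) (hq1 : q < 1) (hm : ζm < 0) (hp : 0 < ζp) (K : ℕ)
    (R : ℝ) {δ : ℝ} (hδ : 0 < δ) : ∃ C, ∀ d ≠ 0, ∀ X : GSpace q ζm ζp (K + d),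
      (X.1 : Set ℝ) ⊆ window q ζm ζp R → HasLargePoints (X.1 : Set ℝ) δ (K + 3) →
      ∀ Y : GSpace q ζm ζp K, |compReal K d X Y| ≤
        C * ∏ i, (window q ζm ζp R).indicator (fun x => |x|) (Y.pt i) := by
  obtain ⟨C, hC, hCb⟩ := exists_peelSum_bound hq hq1 hm hp R hδ (K + 1)
  have hb : 0 < qFactBound q := Real.exp_pos _
  refine ⟨(∏ i : Fin (K + 1), ∏ _j ∈ Finset.Ioi i, (R + R)) *
    (C * ((qFactBound q)⁻¹) ^ (K + 1)), fun d hd X hX hlarge Y => ?_⟩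
  have hpeel := hCb (X.1 : Set ℝ) (Finset.finite_toSet _) hX hlarge
    (fun k => deltaInt q (Y.entry k) d)
    (fun k => (window q ζm ζp R).indicator (fun x => |x|) (Y.entry k) * (qFactBound q)⁻¹)
    (fun k _ => mul_nonneg (Set.indicator_nonneg (fun x _ => abs_nonneg x) _) (inv_pos.2 hb).le)
    fun k _ a ha => abs_deltaInt_le_window hq hq1 hm hp ha hd
  rw [Finset.prod_mul_distrib, Finset.prod_const, Finset.card_range, Finset.prod_range] at hpeel
  simp only [Level.entry_fin] at hpeel
  rw [compReal_eq hq hq1 hm hp, abs_mul, abs_mul, abs_of_pos (normConst_pos hq hq1 _ _)]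
  by_cases hY : ∀ i, Y.pt i ∈ window q ζm ζp R
  · calc normConst q (K + 1) d * |vdm Y.pt| *
          |peelSum (fun k => deltaInt q (Y.entry k) d) (K + 1) (X.1 : Set ℝ)|
        ≤ 1 * (∏ i : Fin (K + 1), ∏ _j ∈ Finset.Ioi i, (R + R)) * _ := by
          refine mul_le_mul (mul_le_mul (normConst_le_one hq hq1 _ _)
            (abs_vdm_le fun i => (hY i).2) (abs_nonneg _) zero_le_one) hpeel (abs_nonneg _) ?_
          rw [one_mul]
          exact (abs_nonneg _).trans (abs_vdm_le fun i => (hY i).2)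
      _ = _ := by ring
  · push Not at hY
    obtain ⟨i, hi⟩ := hY
    have h0 : ∏ i, (window q ζm ζp R).indicator (fun x => |x|) (Y.pt i) = 0 :=
      Finset.prod_eq_zero (Finset.mem_univ i) (Set.indicator_of_notMem hi _)
    rw [h0, zero_mul, mul_zero] at hpeel
    rw [h0, mul_zero, le_antisymm hpeel (abs_nonneg _), mul_zero]

theorem summable_prod_window (hq : 0 < q) (hq1 : q < 1) (hm : ζm < 0) (hp : 0 < ζp) (M : ℕ)
    (R : ℝ) : Summable fun Y : Level q ζm ζp M =>
      ∏ i, (window q ζm ζp R).indicator (fun x => |x|) (Y.pt i) :=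
  (summable_norm_and_hasSum_prod fun _ : Fin M =>
    (summable_window hq hq1 hm hp R).hasSum).2.summable.comp_injective (Level.pt_injective M)

/-- The limit of the row measures of the composite links. -/
theorem tendsto_tsum_compLink (hq : 0 < q) (hq1 : q < 1) (hm : ζm < 0) (hp : 0 < ζp) {K : ℕ}
    {X : ∀ d, GSpace q ζm ζp (K + d)} {Z : Set ℝ}
    (hconv : ConvTo atTop (fun d => ((X d).1 : Set ℝ)) Z) {R δ : ℝ} (hδ : 0 < δ)
    (hX : ∀ᶠ d in atTop, ((X d).1 : Set ℝ) ⊆ window q ζm ζp R)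
    (hlarge : ∀ᶠ d in atTop, HasLargePoints ((X d).1 : Set ℝ) δ (K + 3))
    (A : Set (GSpace q ζm ζp K)) :
    Tendsto (fun d => ∑' Y : A, compLink (Ω := GSpace q ζm ζp) (qLink q ζm ζp) K d (X d) Y) atTop
      (𝓝 (∑' Y : A, ENNReal.ofReal (limReal K Z (Y : GSpace q ζm ζp K)))) := by
  have hlim := tendsto_compReal hq hq1 hm hp le_rfl hconv hδ hX hlarge
  have hnn : ∀ d Y, 0 ≤ compReal K d (X d) Y := fun d Y =>
    (compReal_nonneg_and_compLink_eq hq hq1 hm hp K d (X d) Y).1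
  have hnn' : ∀ Y, 0 ≤ limReal K Z Y := fun Y => ge_of_tendsto' (hlim Y) fun d => hnn d Y
  obtain ⟨C, hC⟩ := exists_compReal_bound hq hq1 hm hp K R hδ
  have hsum : Summable fun Y : GSpace q ζm ζp K =>
      C * ∏ i, (window q ζm ζp R).indicator (fun x => |x|) (Y.pt i) :=
    (summable_prod_window hq hq1 hm hp (K + 1) R).mul_left C
  have hev : ∀ᶠ d in atTop, ∀ Y, |compReal K d (X d) Y| ≤
      C * ∏ i, (window q ζm ζp R).indicator (fun x => |x|) (Y.pt i) := by
    filter_upwards [hX, hlarge, eventually_ne_atTop 0] with d h1 h2 h3 using hC d h3 _ h1 h2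
  have hbound' : ∀ Y, |limReal K Z Y| ≤
      C * ∏ i, (window q ζm ζp R).indicator (fun x => |x|) (Y.pt i) := fun Y =>
    le_of_tendsto (hlim Y).abs (hev.mono fun d hd => hd Y)
  have hsA : Summable fun Y : A => C * ∏ i, (window q ζm ζp R).indicator (fun x => |x|)
    ((Y : GSpace q ζm ζp K).pt i) := hsum.comp_injective Subtype.val_injective
  have hreal : Tendsto (fun d => ∑' Y : A, compReal K d (X d) Y) atTop
      (𝓝 (∑' Y : A, limReal K Z (Y : GSpace q ζm ζp K))) :=
    tendsto_tsum_of_dominated_convergence hsA (fun Y => hlim Y) (hev.mono fun d hd Y => hd Y)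
  rw [← ENNReal.ofReal_tsum_of_nonneg (fun Y : A => hnn' Y)
    (Summable.of_norm_bounded hsA fun Y => hbound' Y)]
  refine (ENNReal.tendsto_ofReal hreal).congr' ?_
  filter_upwards [hev] with d hd
  rw [ENNReal.ofReal_tsum_of_nonneg (fun Y : A => hnn d Y)
    (Summable.of_norm_bounded hsA fun Y => hd Y)]
  exact tsum_congr fun Y => (compReal_nonneg_and_compLink_eq hq hq1 hm hp K d (X d) Y).2.symm

/-! ### The limit measures determine the configuration -/

theorem finite_window_ge (hq : 0 < q) (hq1 : q < 1) (hm : ζm < 0) (hp : 0 < ζp) (R : ℝ) {r : ℝ}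
    (hr : 0 < r) : {x ∈ window q ζm ζp R | r ≤ |x|}.Finite := by
  have h := (summable_window hq hq1 hm hp R).tendsto_cofinite_zero.eventually_lt_const hr
  rw [Filter.eventually_cofinite] at h
  refine h.subset fun x hx => ?_
  simp only [Set.mem_ofPred_eq, not_lt]
  rw [Set.indicator_of_mem hx.1]
  exact hx.2

/-- The matrix `deltaLim q y a` is unitriangular: it is 1 on the diagonal and vanishes unless y is
on the orbit of a, hence |a| ≥ |y|. Only finitely many points of the window have modulus above a
given level, so the system can be solved from the largest modulus down. -/
theorem eq_of_tsum_deltaLim_eq (hq : 0 < q) (hq1 : q < 1) (hm : ζm < 0) (hp : 0 < ζp) {R : ℝ}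
    {w w' : ℝ → ℝ} (hw : ∀ a ∉ window q ζm ζp R, w a = 0) (hw' : ∀ a ∉ window q ζm ζp R, w' a = 0)
    (h : ∀ y ∈ qLattice q ζm ζp, ∑' a, deltaLim q y a * w a = ∑' a, deltaLim q y a * w' a) :
    w = w' := by
  by_contra hne
  obtain ⟨a₀, ha₀⟩ := Function.ne_iff.1 hne
  have hD : ∀ a, w a ≠ w' a → a ∈ window q ζm ζp R := fun a ha => by
    by_contra h'
    exact ha ((hw a h').trans (hw' a h').symm)
  have h0 : ∀ a ∈ window q ζm ζp R, a ≠ 0 := fun a ha => ne_zero_of_mem_qLattice hq hm hp ha.1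
  have hfin := finite_window_ge hq hq1 hm hp R (abs_pos.2 (h0 a₀ (hD a₀ ha₀)))
  -- At a point y of largest modulus where the weights differ, every other difference is killed by
  -- triangularity; the point -y is excluded because it lies on the other half of the lattice.
  obtain ⟨y, ⟨hy, hya⟩, hmax⟩ := Set.exists_max_image {a | w a ≠ w' a ∧ |a₀| ≤ |a|} (fun a => |a|)
    (hfin.subset fun a ha => ⟨hD a ha.1, ha.2⟩) ⟨a₀, ha₀, le_rfl⟩
  have hyW := hD y hy
  have hyfin := finite_window_ge hq hq1 hm hp R (abs_pos.2 (h0 y hyW))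
  have hsupp : ∀ u : ℝ → ℝ, (∀ a ∉ window q ζm ζp R, u a = 0) →
      Summable fun a => deltaLim q y a * u a := fun u hu => by
    refine summable_of_hasFiniteSupport (hyfin.subset fun a ha => ?_)
    have haW : a ∈ window q ζm ζp R := by
      by_contra h'
      exact ha (by simp [hu a h'])
    refine ⟨haW, ?_⟩
    by_contra h'
    refine ha ?_
    have : y ∉ orbit q a := fun h'' => h' ((mem_orbit_iff hq hq1 hm hp haW.1).1 h'').2.2
    simp [deltaLim_eq_zero hq hq1 (h0 a haW) this]
  have hdiff : ∑' a, (deltaLim q y a * w a - deltaLim q y a * w' a) = 0 := by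
    rw [(hsupp w hw).tsum_sub (hsupp w' hw'), h y hyW.1, sub_self]
  rw [tsum_eq_single y, deltaLim_self hq hq1 (h0 y hyW), one_mul, one_mul, sub_eq_zero] at hdiff
  · exact hy hdiff
  · intro a hay
    rw [← mul_sub]
    by_cases ha : w a = w' a
    · rw [ha, sub_self, mul_zero]
    · rw [deltaLim_eq_zero hq hq1 (h0 a (hD a ha)), zero_mul]
      intro hmem
      have h1 := (mem_orbit_iff hq hq1 hm hp (hD a ha).1).1 hmem
      have h2 := hmax a ⟨ha, hya.trans h1.2.2⟩
      rcases abs_eq_abs.1 (le_antisymm h2 h1.2.2) with h3 | h3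
      · exact hay h3
      · rw [h3] at h1
        nlinarith [mul_self_nonneg y]

theorem limReal_zero {y : ℝ} {Y : GSpace q ζm ζp 0} (hY : Y.pt = fun _ => y) (Z : Set ℝ) :
    limReal 0 Z Y = normLim q 1 *
      ∑' a, deltaLim q y a * Z.indicator (fun a => (coprod Z a)⁻¹) a := by
  have h1 : vdm Y.pt = 1 := by simp [vdm]
  have h2 : Y.entry 0 = y := by
    rw [← congrFun hY 0]
    exact Y.entry_fin 0
  rw [limReal, h1, mul_one, peelSum]
  congr 1
  refine tsum_congr fun a => ?_
  by_cases ha : a ∈ Z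
  · simp [ha, h2, peelSum]
  · simp [ha]

/-- The weights 1/`coprod Z a` are recovered by triangularity, and Z is their support. -/
theorem eq_of_limReal_zero_eq (hq : 0 < q) (hq1 : q < 1) (hm : ζm < 0) (hp : 0 < ζp) {R : ℝ}
    {Z Z' : Set ℝ} (hZ : Z ⊆ window q ζm ζp R) (hZ' : Z' ⊆ window q ζm ζp R)
    (hc : ∀ a ∈ Z, coprod Z a ≠ 0) (hc' : ∀ a ∈ Z', coprod Z' a ≠ 0)
    (h : ∀ Y : GSpace q ζm ζp 0, limReal 0 Z Y = limReal 0 Z' Y) : Z = Z' := by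
  have hw := eq_of_tsum_deltaLim_eq hq hq1 hm hp (R := R)
    (w := Z.indicator fun a => (coprod Z a)⁻¹) (w' := Z'.indicator fun a => (coprod Z' a)⁻¹)
    (fun a ha => Set.indicator_of_notMem (fun h => ha (hZ h)) _)
    (fun a ha => Set.indicator_of_notMem (fun h => ha (hZ' h)) _) fun y hy => by
      obtain ⟨Y, hY⟩ := exists_level_pt_eq (q := q) (ζm := ζm) (ζp := ζp) (N := 1)
        (y := fun _ => y) (fun i j hij => absurd (Subsingleton.elim i j) hij.ne) fun _ => hy
      have := h Y
      rw [limReal_zero hY, limReal_zero hY] at this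
      exact mul_left_cancel₀ (normLim_one_pos hq hq1).ne' this
  have hsupp : ∀ S : Set ℝ, (∀ a ∈ S, coprod S a ≠ 0) →
      Function.support (S.indicator fun a => (coprod S a)⁻¹) = S := fun S hS => by
    rw [Set.support_indicator, Set.inter_eq_left]
    exact fun a ha => inv_ne_zero (hS a ha)
  rw [← hsupp Z hc, ← hsupp Z' hc', hw]

/-! ### Convergent sequences of configurations are regular -/

/-- Pointwise convergence of uniformly bounded configurations. -/
def Converges (X : ∀ n, GSpace q ζm ζp n) (Z : Set ℝ) : Prop :=
  ConvTo atTop (fun n => ((X n).1 : Set ℝ)) Z ∧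
    ∃ R, ∀ᶠ n in atTop, ((X n).1 : Set ℝ) ⊆ window q ζm ζp R

theorem exists_hasLargePoints {ι : Type*} {l : Filter ι} {X : ι → Set ℝ} {Z : Set ℝ}
    (h : ConvTo l X Z) (hZ : Z.Infinite) (hZ0 : ∀ x ∈ Z, x ≠ 0) (m : ℕ) :
    ∃ δ > 0, ∀ᶠ i in l, HasLargePoints (X i) δ m := by
  obtain ⟨B, hB, hcard⟩ := hZ.exists_subset_card_eq m
  obtain ⟨δ, hδ, hBδ⟩ : ∃ δ > 0, ∀ x ∈ B, δ ≤ |x| := by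
    rcases B.eq_empty_or_nonempty with rfl | hne
    · exact ⟨1, one_pos, by simp⟩
    · obtain ⟨y, hy, hmin⟩ := B.exists_min_image (fun x => |x|) hne
      exact ⟨|y|, abs_pos.2 (hZ0 y (hB hy)), hmin⟩
  refine ⟨δ, hδ, ?_⟩
  have : ∀ᶠ i in l, ∀ x ∈ B, (x ∈ X i ↔ x ∈ Z) := (eventually_all_finset B).2 fun x _ => h x
  filter_upwards [this] with i hi
  exact ⟨B, fun x hx => (hi x hx).2 (hB hx), hcard.ge, hBδ⟩

theorem Converges.exists_pmf (hq : 0 < q) (hq1 : q < 1) (hm : ζm < 0) (hp : 0 < ζp)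
    {X : ∀ n, GSpace q ζm ζp n} {Z : Set ℝ} (h : Converges X Z) (hZ : Z.Infinite) (K : ℕ) :
    ∃ M : PMF (GSpace q ζm ζp K), RowsConverge (Ω := GSpace q ζm ζp) (qLink q ζm ζp) X K M ∧
      ∀ Y, 0 ≤ limReal K Z Y ∧ M Y = ENNReal.ofReal (limReal K Z Y) := by
  obtain ⟨hconv, R, hR⟩ := h
  have hZ0 : ∀ x ∈ Z, x ≠ 0 := fun x hx =>
    ne_zero_of_mem_qLattice hq hm hp (hconv.subset_window hR hx).1
  obtain ⟨δ, hδ, hlarge⟩ := exists_hasLargePoints hconv hZ hZ0 (K + 3)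
  have hshift : Tendsto (fun d => K + d) atTop atTop :=
    tendsto_atTop_mono (fun d => Nat.le_add_left d K) tendsto_id
  have hconv' : ConvTo atTop (fun d => ((X (K + d)).1 : Set ℝ)) Z := fun x =>
    hshift.eventually (hconv x)
  have hlim := tendsto_tsum_compLink hq hq1 hm hp (X := fun d => X (K + d)) hconv' hδ
    (hshift.eventually hR) (hshift.eventually hlarge)
  -- No mass escapes: every row has total mass 1, and convergence holds on the whole space.
  have hone : ∑' Y, ENNReal.ofReal (limReal K Z (Y : GSpace q ζm ζp K)) = 1 := by
    have := hlim Set.univ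
    simp only [tsum_univ (f := fun Y : GSpace q ζm ζp K => ENNReal.ofReal (limReal K Z Y)),
      tsum_univ (f := compLink (Ω := GSpace q ζm ζp) (qLink q ζm ζp) K _ (X (K + _))),
      tsum_compLink hq hq1 hm hp] at this
    exact tendsto_nhds_unique this tendsto_const_nhds
  exact ⟨⟨fun Y => ENNReal.ofReal (limReal K Z Y), hone ▸ ENNReal.summable.hasSum⟩, hlim,
    fun Y => ⟨ge_of_tendsto' (tendsto_compReal hq hq1 hm hp le_rfl hconv' hδ
      (hshift.eventually hR) (hshift.eventually hlarge) Y)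
      fun d => (compReal_nonneg_and_compLink_eq hq hq1 hm hp K d _ Y).1, rfl⟩⟩

theorem RowsConverge.tendsto_apply {Ω : ℕ → Type*} {Λ : ∀ n, Ω (n + 1) → Ω n → ℝ≥0∞}
    {x : ∀ n, Ω n} {K : ℕ} {M : PMF (Ω K)} (h : RowsConverge Λ x K M) (y : Ω K) :
    Tendsto (fun d => compLink Λ K d (x (K + d)) y) atTop (𝓝 (M y)) := by
  have := h {y}
  simp only [tsum_singleton y M, tsum_singleton y (compLink Λ K _ (x (K + _)))] at this
  exact this

theorem RowsConverge.unique {Ω : ℕ → Type*} {Λ : ∀ n, Ω (n + 1) → Ω n → ℝ≥0∞}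
    {x : ∀ n, Ω n} {K : ℕ} {M M' : PMF (Ω K)} (h : RowsConverge Λ x K M)
    (h' : RowsConverge Λ x K M') : M = M' :=
  PMF.ext fun y => tendsto_nhds_unique (h.tendsto_apply y) (h'.tendsto_apply y)

/-! ### Regular sequences are bounded -/

/-- For the point y of largest modulus only a = y contributes to the sum, so the entry is `qFact q
d` / ∏(1 - x/y). All |x/y| ≤ 1 here, and their sum is bounded, so the product is positive and
bounded above. -/
theorem exists_compReal_zero_ge (hq : 0 < q) (hq1 : q < 1) (hm : ζm < 0) (hp : 0 < ζp) (d : ℕ)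
    (X : GSpace q ζm ζp (0 + d)) : ∃ Y : GSpace q ζm ζp 0, (∀ x ∈ X.1, |x| ≤ |Y.pt 0|) ∧
      qFactBound q * Real.exp (-(2 * (1 - q)⁻¹)) ≤ compReal 0 d X Y := by
  have hne : X.1.Nonempty := Finset.card_pos.1 (by rw [X.2.2]; omega)
  have hL : ∀ x ∈ X.1, x ∈ qLattice q ζm ζp := fun x hx => X.2.1 hx
  obtain ⟨y, hy, hmax⟩ := X.1.exists_max_image (fun x => |x|) hne
  have hyL := hL y hy
  have hy0 := ne_zero_of_mem_qLattice hq hm hp hyL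
  have hy0' := abs_pos.2 hy0
  obtain ⟨Y, hY⟩ := exists_level_pt_eq (q := q) (ζm := ζm) (ζp := ζp) (N := 1)
    (y := fun _ => y) (fun i j hij => absurd (Subsingleton.elim i j) hij.ne) fun _ => hyL
  refine ⟨Y, fun x hx => by rw [hY]; exact hmax x hx, ?_⟩
  have h1 : vdm Y.pt = 1 := by simp [vdm]
  have h2 : Y.entry 0 = y := by
    rw [← congrFun hY 0]
    exact Y.entry_fin 0
  have h3 : peelSum (fun k => deltaInt q (Level.entry Y k) d) (0 + 1) (X.1 : Set ℝ) =
      (coprod (X.1 : Set ℝ) y)⁻¹ := by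
    rw [peelSum, tsum_eq_single y]
    · rw [Set.indicator_of_mem (Finset.mem_coe.2 hy), h2, deltaInt_self hq hq1 hy0]
      simp [peelSum]
    · intro a ha
      by_cases haX : a ∈ (X.1 : Set ℝ)
      · rw [Set.indicator_of_mem haX, h2, deltaInt_eq_zero]
        · simp
        · intro hmem
          have h4 := (mem_orbit_iff hq hq1 hm hp (hL a haX)).1 hmem
          rcases abs_eq_abs.1 (le_antisymm (hmax a haX) h4.2.2) with h5 | h5
          · exact ha h5
          · rw [h5] at h4
            nlinarith [mul_self_nonneg y]
      · rw [Set.indicator_of_notMem haX]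
  have hfac : ∀ x ∈ X.1.erase y, 0 < 1 - x / y ∧ 1 - x / y ≤ Real.exp (|x| / |y|) := by
    intro x hx
    have hx' := hmax x (Finset.mem_of_mem_erase hx)
    have hle : |x / y| ≤ 1 := by
      rw [abs_div]
      exact (div_le_one hy0').2 hx'
    have hne1 : x / y ≠ 1 := fun h => Finset.ne_of_mem_erase hx ((div_eq_one_iff_eq hy0).1 h)
    refine ⟨sub_pos.2 (lt_of_le_of_ne ((le_abs_self _).trans hle) hne1), ?_⟩
    rw [← abs_div]
    have := Real.add_one_le_exp |x / y|
    have := neg_abs_le (x / y)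
    linarith
  have h4 : 0 < coprod (X.1 : Set ℝ) y := by
    rw [coprod_finset]
    exact Finset.prod_pos fun x hx => (hfac x hx).1
  have h5 : coprod (X.1 : Set ℝ) y ≤ Real.exp (2 * (1 - q)⁻¹) := by
    rw [coprod_finset]
    refine (Finset.prod_le_prod (fun x hx => (hfac x hx).1.le) fun x hx => (hfac x hx).2).trans ?_
    rw [← Real.exp_sum, Real.exp_le_exp]
    exact sum_abs_div_le hq hq1 hm hp (fun x hx => hL x (Finset.mem_of_mem_erase hx)) hy0'
      fun x hx => hmax x (Finset.mem_of_mem_erase hx)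
  rw [compReal_eq hq hq1 hm hp, h1, mul_one, h3, Real.exp_neg]
  have h6 : normConst q (0 + 1) d = qFact q d := normConst_one hq hq1 d
  rw [h6]
  have h7 := qFact_pos hq hq1 d
  have h8 := qFactBound_le hq hq1 d
  gcongr

theorem eventually_of_shift {P : Finset ℝ → Prop} {X : ∀ n, GSpace q ζm ζp n} {K : ℕ}
    (h : ∀ᶠ d in atTop, P (X (K + d)).1) : ∀ᶠ n in atTop, P (X n).1 := by
  obtain ⟨d₀, hd₀⟩ := eventually_atTop.1 h
  refine eventually_atTop.2 ⟨K + d₀, fun n hn => ?_⟩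
  obtain ⟨d, rfl⟩ := Nat.exists_eq_add_of_le ((Nat.le_add_right K d₀).trans hn)
  exact hd₀ d (by omega)

theorem exists_window_of_rowsConverge (hq : 0 < q) (hq1 : q < 1) (hm : ζm < 0) (hp : 0 < ζp)
    {X : ∀ n, GSpace q ζm ζp n} {M : PMF (GSpace q ζm ζp 0)}
    (h : RowsConverge (Ω := GSpace q ζm ζp) (qLink q ζm ζp) X 0 M) :
    ∃ R, ∀ᶠ n in atTop, ((X n).1 : Set ℝ) ⊆ window q ζm ζp R := by
  classical
  set c : ℝ := qFactBound q * Real.exp (-(2 * (1 - q)⁻¹)) with hc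
  have hc0 : 0 < c := mul_pos (Real.exp_pos _) (Real.exp_pos _)
  have hlt : 1 - ENNReal.ofReal c < 1 :=
    ENNReal.sub_lt_self ENNReal.one_ne_top one_ne_zero (ENNReal.ofReal_pos.2 hc0).ne'
  obtain ⟨s, hs⟩ := (M.2.eventually_const_lt hlt).exists
  have hs' : 1 - ENNReal.ofReal c < ∑' Y : (s : Set (GSpace q ζm ζp 0)), M Y := by
    rw [Finset.tsum_subtype' s M]
    exact hs
  -- The finite set s carries limit mass more than 1 - c, so it must eventually contain the point of
  -- mass at least c found above. The sum over s is a convenient bound for the maximal modulus.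
  refine ⟨∑ Y ∈ s, |Y.pt 0|, eventually_of_shift (K := 0)
    (P := fun X => (X : Set ℝ) ⊆ window q ζm ζp (∑ Y ∈ s, |Y.pt 0|)) ?_⟩
  filter_upwards [(h s).eventually_const_lt hs'] with d hd
  obtain ⟨Y, hYmax, hY⟩ := exists_compReal_zero_ge hq hq1 hm hp d (X (0 + d))
  have hYs : Y ∈ s := by
    by_contra hYs
    have h1 := ENNReal.sum_le_tsum
      (f := compLink (Ω := GSpace q ζm ζp) (qLink q ζm ζp) 0 d (X (0 + d))) (insert Y s)
    rw [tsum_compLink hq hq1 hm hp, Finset.sum_insert hYs,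
      (compReal_nonneg_and_compLink_eq hq hq1 hm hp 0 d (X (0 + d)) Y).2] at h1
    rw [Finset.tsum_subtype' s] at hd
    refine absurd h1 (not_le.2 ?_)
    have h2 := ENNReal.ofReal_le_ofReal hY
    calc (1 : ℝ≥0∞) ≤ ENNReal.ofReal c + (1 - ENNReal.ofReal c) := le_add_tsub
      _ < ENNReal.ofReal c + ∑ Z ∈ s, compLink (qLink q ζm ζp) 0 d (X (0 + d)) Z :=
          ENNReal.add_lt_add_left ENNReal.ofReal_ne_top hd
      _ ≤ _ := by gcongr
  intro x hx
  exact ⟨(X (0 + d)).2.1 hx, (hYmax x hx).trans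
    (Finset.single_le_sum (f := fun Y : GSpace q ζm ζp 0 => |Y.pt 0|)
      (fun _ _ => abs_nonneg _) hYs)⟩

/-! ### Regular sequences keep their particles away from zero -/

/-- A nonzero iterated sum has a nonzero term, that is, K distinct points of X at each of which the
corresponding function does not vanish. -/
theorem hasLargePoints_of_peelSum_ne_zero {g : ℕ → ℝ → ℝ} {δ : ℝ} {K : ℕ} {X : Set ℝ}
    (hg : ∀ k < K, ∀ a ∈ X, g k a ≠ 0 → δ ≤ |a|) (h : peelSum g K X ≠ 0) :
    HasLargePoints X δ K := by
  classical
  induction K generalizing X with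
  | zero => exact ⟨∅, by simp, by simp, by simp⟩
  | succ K ih =>
    have : ∃ a, X.indicator (fun a => g K a * (a ^ K)⁻¹ * (coprod X a)⁻¹ *
        peelSum g K (X \ {a})) a ≠ 0 := by
      by_contra! h'
      exact h (by rw [peelSum]; simp only [h', tsum_zero])
    obtain ⟨a, ha⟩ := this
    have haX : a ∈ X := by
      by_contra h'
      exact ha (Set.indicator_of_notMem h' _)
    rw [Set.indicator_of_mem haX] at ha
    obtain ⟨B, hB, hcard, hBδ⟩ := ih (X := X \ {a}) (fun k hk b hb => hg k (by omega) b hb.1)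
      (right_ne_zero_of_mul ha)
    have haB : a ∉ B := fun h' => (hB h').2 rfl
    refine ⟨insert a B, ?_, ?_, ?_⟩
    · rw [Finset.coe_insert]
      exact Set.insert_subset haX (hB.trans Set.sdiff_subset)
    · rw [Finset.card_insert_of_notMem haB]
      omega
    · intro x hx
      rcases Finset.mem_insert.1 hx with rfl | hx
      · exact hg K K.lt_succ_self _ haX
          (left_ne_zero_of_mul (left_ne_zero_of_mul (left_ne_zero_of_mul ha)))
      · exact hBδ x hx

/-- Take Y of positive limit mass. Once its entry is positive, every point of Y lies on the orbit of
its own point of X, and orbits only decrease the modulus. -/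
theorem exists_hasLargePoints_of_rowsConverge (hq : 0 < q) (hq1 : q < 1) (hm : ζm < 0)
    (hp : 0 < ζp) {X : ∀ n, GSpace q ζm ζp n} {K : ℕ} {M : PMF (GSpace q ζm ζp K)}
    (h : RowsConverge (Ω := GSpace q ζm ζp) (qLink q ζm ζp) X K M) :
    ∃ δ > 0, ∀ᶠ n in atTop, HasLargePoints ((X n).1 : Set ℝ) δ (K + 1) := by
  obtain ⟨Y, hY⟩ := M.support_nonempty
  obtain ⟨i, -, hi⟩ := Finset.univ.exists_min_image (fun i => |Y.pt i|) ⟨0, Finset.mem_univ _⟩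
  refine ⟨|Y.pt i|, abs_pos.2 (ne_zero_of_mem_qLattice hq hm hp (Y.pt_mem_qLattice i)),
    eventually_of_shift (K := K) (P := fun X => HasLargePoints (X : Set ℝ) |Y.pt i| (K + 1)) ?_⟩
  have hpos : 0 < M Y := pos_iff_ne_zero.2 hY
  filter_upwards [(h.tendsto_apply Y).eventually_const_lt hpos] with d hd
  rw [(compReal_nonneg_and_compLink_eq hq hq1 hm hp K d (X (K + d)) Y).2, ENNReal.ofReal_pos,
    compReal_eq hq hq1 hm hp] at hd
  refine hasLargePoints_of_peelSum_ne_zero (fun k hk a ha hne => ?_)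
    (right_ne_zero_of_mul hd.ne')
  rw [Y.entry_fin ⟨k, hk⟩] at hne
  have hmem : Y.pt ⟨k, hk⟩ ∈ orbit q a := by
    by_contra h'
    exact hne (deltaInt_eq_zero h' d)
  exact (hi ⟨k, hk⟩ (Finset.mem_univ _)).trans
    ((mem_orbit_iff hq hq1 hm hp ((X (K + d)).2.1 ha)).1 hmem).2.2

/-! ### Regular sequences converge -/

/-- The pointwise limit of a sequence of configurations along an ultrafilter. -/
def ultraLim (U : Ultrafilter ℕ) (X : ∀ n, GSpace q ζm ζp n) : Set ℝ :=
  {x | ∀ᶠ n in (U : Filter ℕ), x ∈ (X n).1}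

theorem convTo_ultraLim (U : Ultrafilter ℕ) (X : ∀ n, GSpace q ζm ζp n) :
    ConvTo (U : Filter ℕ) (fun n => ((X n).1 : Set ℝ)) (ultraLim U X) := by
  intro x
  by_cases hx : x ∈ ultraLim U X
  · have h : ∀ᶠ n in (U : Filter ℕ), x ∈ (X n).1 := hx
    exact h.mono fun n hn => ⟨fun _ => hx, fun _ => hn⟩
  · have h : ∀ᶠ n in (U : Filter ℕ), x ∉ (X n).1 := Ultrafilter.eventually_not.2 hx
    exact h.mono fun n hn => ⟨fun h' => absurd h' hn, fun h' => absurd h' hx⟩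

theorem exists_converges_of_isRegular (hq : 0 < q) (hq1 : q < 1) (hm : ζm < 0) (hp : 0 < ζp)
    {X : ∀ n, GSpace q ζm ζp n} (h : IsRegular (Ω := GSpace q ζm ζp) (qLink q ζm ζp) X) :
    ∃ Z : Set ℝ, Z.Infinite ∧ Converges X Z := by
  obtain ⟨M, hM⟩ := h 0
  obtain ⟨R, hR⟩ := exists_window_of_rowsConverge hq hq1 hm hp hM
  have hlarge : ∀ m, ∃ δ > 0, ∀ᶠ n in atTop, HasLargePoints ((X n).1 : Set ℝ) δ (m + 1) :=
    fun m => by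
      obtain ⟨M', hM'⟩ := h m
      exact exists_hasLargePoints_of_rowsConverge hq hq1 hm hp hM'
  have hwin : ∀ U : Ultrafilter ℕ, (U : Filter ℕ) ≤ atTop → ultraLim U X ⊆ window q ζm ζp R :=
    fun U hU => (convTo_ultraLim U X).subset_window (hU hR)
  have hne : ∀ U : Ultrafilter ℕ, (U : Filter ℕ) ≤ atTop →
      ∀ a ∈ ultraLim U X, coprod (ultraLim U X) a ≠ 0 := fun U hU a ha =>
    abs_pos.1 ((coprodBound_pos (q := q)).trans_le (abs_coprod_ge_of_tendsto hq hq1 hm hp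
      (convTo_ultraLim U X) (hU hR) (Eventually.of_forall fun n => Finset.finite_toSet _)
      (hwin U hU ha).1))
  have hshift : ∀ d, ((X (0 + d)).1 : Set ℝ) = (X d).1 := fun d => by rw [Nat.zero_add]
  have hval : ∀ U : Ultrafilter ℕ, (U : Filter ℕ) ≤ atTop → ∀ Y : GSpace q ζm ζp 0,
      limReal 0 (ultraLim U X) Y = (M Y).toReal := by
    intro U hU Y
    obtain ⟨δ, hδ, hδ'⟩ := hlarge 2
    have h1 := tendsto_compReal hq hq1 hm hp (K := 0) hU (X := fun d => X (0 + d))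
      (Z := ultraLim U X) (R := R) (δ := δ) (by simpa only [hshift] using convTo_ultraLim U X) hδ
      (by simpa only [hshift] using hR.filter_mono hU)
      (by simpa only [hshift] using hδ'.filter_mono hU) Y
    have h2 := (ENNReal.tendsto_toReal (M.apply_ne_top Y)).comp ((hM.tendsto_apply Y).mono_left hU)
    refine tendsto_nhds_unique h1 (h2.congr fun d => ?_)
    obtain ⟨h3, h4⟩ := compReal_nonneg_and_compLink_eq hq hq1 hm hp 0 d (X (0 + d)) Y
    rw [Function.comp_apply, h4, ENNReal.toReal_ofReal h3]
  -- All ultrafilter limits have the same limit measure on one-point configurations, hence coincide.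
  have heq : ∀ U V : Ultrafilter ℕ, (U : Filter ℕ) ≤ atTop → (V : Filter ℕ) ≤ atTop →
      ultraLim U X = ultraLim V X := fun U V hU hV =>
    eq_of_limReal_zero_eq hq hq1 hm hp (hwin U hU) (hwin V hV) (hne U hU) (hne V hV) fun Y => by
      rw [hval U hU, hval V hV]
  let U : Ultrafilter ℕ := Ultrafilter.of atTop
  have hU : (U : Filter ℕ) ≤ atTop := Ultrafilter.of_le atTop
  refine ⟨ultraLim U X, fun hfin => ?_, fun x => ?_, R, hR⟩
  -- A limit with m points is impossible: m + 1 points stay in a finite part of the lattice, where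
  -- X(n) agrees with the limit for some n.
  · obtain ⟨δ, hδ, hδ'⟩ := hlarge (ultraLim U X).ncard
    have hF := finite_window_ge hq hq1 hm hp R hδ
    have hag : ∀ᶠ n in (U : Filter ℕ), ∀ x ∈ {x ∈ window q ζm ζp R | δ ≤ |x|},
        (x ∈ (X n).1 ↔ x ∈ ultraLim U X) :=
      (eventually_all_finite hF).2 fun x _ => convTo_ultraLim U X x
    obtain ⟨n, hn, hn', B, hB, hcard, hBδ⟩ := (hag.and ((hR.filter_mono hU).and (hδ'.filter_mono hU))).exists
    have hsub : (B : Set ℝ) ⊆ ultraLim U X := fun x hx =>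
      (hn x ⟨hn' (hB hx), hBδ x hx⟩).1 (hB hx)
    have := Set.ncard_le_ncard hsub hfin
    rw [Set.ncard_coe_finset] at this
    omega
  · by_contra hx
    -- If membership of x fails to settle, an ultrafilter concentrated on the exceptional indices
    -- has a limit that differs at x.
    have hfr : ∃ᶠ n in atTop, n ∈ {n | ¬(x ∈ ((X n).1 : Set ℝ) ↔ x ∈ ultraLim U X)} :=
      (not_eventually.1 hx).mono fun n hn => hn
    have hbot := frequently_mem_iff_neBot.1 hfr
    let V : Ultrafilter ℕ := Ultrafilter.of (atTop ⊓ 𝓟 {n | ¬(x ∈ ((X n).1 : Set ℝ) ↔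
      x ∈ ultraLim U X)})
    have hV := Ultrafilter.of_le (atTop ⊓ 𝓟 {n | ¬(x ∈ ((X n).1 : Set ℝ) ↔ x ∈ ultraLim U X)})
    have h1 := convTo_ultraLim V X x
    rw [heq V U (hV.trans inf_le_left) hU] at h1
    have h2 : ∀ᶠ n in (V : Filter ℕ), ¬(x ∈ ((X n).1 : Set ℝ) ↔ x ∈ ultraLim U X) :=
      (hV.trans inf_le_right) (mem_principal_self _)
    obtain ⟨n, hn, hn'⟩ := (h1.and h2).exists
    exact hn' hn

/-! ### The variational series -/

theorem before_irrefl (x : ℝ) : ¬Before x x := fun h =>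
  h.elim (lt_irrefl _) fun h => lt_irrefl _ h.2

theorem Before.trans {x y z : ℝ} (h : Before x y) (h' : Before y z) : Before x z := by
  unfold Before at *
  grind

theorem before_trichotomy (x y : ℝ) : Before x y ∨ x = y ∨ Before y x := by
  unfold Before
  rcases lt_trichotomy |x| |y| with h | h | h
  · exact Or.inr (Or.inr (Or.inl h))
  · rcases lt_trichotomy x y with h' | h' | h'
    · exact Or.inr (Or.inr (Or.inr ⟨h.symm, h'⟩))
    · exact Or.inr (Or.inl h')
    · exact Or.inl (Or.inr ⟨h, h'⟩)
  · exact Or.inl (Or.inl h)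

theorem Before.abs_le {x y : ℝ} (h : Before x y) : |y| ≤ |x| :=
  h.elim le_of_lt fun h => h.1.ge

/-- The points of a configuration before a given point. -/
def predecessors (X : Set ℝ) (x : ℝ) : Set ℝ := {y ∈ X | Before y x}

theorem finite_predecessors (hq : 0 < q) (hq1 : q < 1) (hm : ζm < 0) (hp : 0 < ζp) {X : Set ℝ}
    {R : ℝ} (hX : X ⊆ window q ζm ζp R) {x : ℝ} (hx : x ≠ 0) : (predecessors X x).Finite :=
  (finite_window_ge hq hq1 hm hp R (abs_pos.2 hx)).subset fun _ hy => ⟨hX hy.1, hy.2.abs_le⟩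

theorem predecessors_ssubset {X : Set ℝ} {x y : ℝ} (hx : x ∈ X) (h : Before x y) :
    predecessors X x ⊂ predecessors X y := by
  exact Set.ssubset_iff_exists.2
    ⟨fun z hz => ⟨hz.1, hz.2.trans h⟩, x, ⟨hx, h⟩, fun h' => before_irrefl x h'.2⟩

theorem varSeries_eq_of_encard (hq : 0 < q) (hq1 : q < 1) (hm : ζm < 0) (hp : 0 < ζp)
    {X : Set ℝ} {R : ℝ} (hX : X ⊆ window q ζm ζp R) {x : ℝ} (hx : x ∈ X) {k : ℕ}
    (hk : (predecessors X x).encard = k) : varSeries X k = x := by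
  have h : ∃ x ∈ X, {y ∈ X | Before y x}.encard = k := ⟨x, hx, hk⟩
  rw [varSeries, dif_pos h]
  obtain ⟨h1, h2⟩ := h.choose_spec
  have h0 : ∀ z ∈ X, z ≠ 0 := fun z hz => ne_zero_of_mem_qLattice hq hm hp (hX hz).1
  rcases before_trichotomy h.choose x with h3 | h3 | h3
  · have := (finite_predecessors hq hq1 hm hp hX (h0 _ h1)).encard_lt_encard
      (predecessors_ssubset h1 h3)
    rw [hk, predecessors, h2] at this
    exact absurd this (lt_irrefl _)
  · exact h3
  · have := (finite_predecessors hq hq1 hm hp hX (h0 _ hx)).encard_lt_encard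
      (predecessors_ssubset hx h3)
    rw [hk, predecessors, h2] at this
    exact absurd this (lt_irrefl _)

theorem mem_of_varSeries_ne_zero {X : Set ℝ} {k : ℕ} (h : varSeries X k ≠ 0) :
    varSeries X k ∈ X ∧ (predecessors X (varSeries X k)).encard = k := by
  have h' : ∃ x ∈ X, {y ∈ X | Before y x}.encard = k := by
    by_contra h'
    exact h (by rw [varSeries, dif_neg h'])
  rw [varSeries, dif_pos h']
  exact h'.choose_spec

/-- Every rank occurs among the points of an infinite configuration. -/
theorem exists_encard_predecessors_eq (hq : 0 < q) (hq1 : q < 1) (hm : ζm < 0) (hp : 0 < ζp)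
    {Z : Set ℝ} {R : ℝ} (hZ : Z ⊆ window q ζm ζp R) (hinf : Z.Infinite) (k : ℕ) :
    ∃ z ∈ Z, (predecessors Z z).encard = k := by
  have h0 : ∀ z ∈ Z, z ≠ 0 := fun z hz => ne_zero_of_mem_qLattice hq hm hp (hZ hz).1
  have hfin : ∀ z ∈ Z, (predecessors Z z).Finite := fun z hz =>
    finite_predecessors hq hq1 hm hp hZ (h0 z hz)
  let r : ℝ → ℕ := fun z => (predecessors Z z).ncard
  have hlt : ∀ x ∈ Z, ∀ y ∈ Z, Before x y → r x < r y := fun x hx y hy h =>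
    Set.ncard_lt_ncard (predecessors_ssubset hx h) (hfin y hy)
  have hinj : Set.InjOn r Z := fun x hx y hy h => by
    rcases before_trichotomy x y with h' | h' | h'
    · exact absurd h (hlt x hx y hy h').ne
    · exact h'
    · exact absurd h.symm (hlt y hy x hx h').ne
  obtain ⟨n, ⟨x, hx, rfl⟩, hn⟩ := (hinf.image hinj).exists_gt k
  have hmaps : ∀ y ∈ predecessors Z x, r y ∈ Finset.range (r x) := fun y hy =>
    Finset.mem_range.2 (hlt y hy.1 x hx hy.2)
  have himg : r '' predecessors Z x = (Finset.range (r x) : Set ℕ) := by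
    refine Set.eq_of_subset_of_ncard_le (by rintro _ ⟨y, hy, rfl⟩; exact hmaps y hy) ?_
      (Finset.finite_toSet _)
    rw [Set.ncard_coe_finset, Finset.card_range,
      (hinj.mono fun y hy => hy.1).ncard_image]
  have hk : k ∈ r '' predecessors Z x := by
    rw [himg]
    exact Finset.mem_coe.2 (Finset.mem_range.2 hn)
  obtain ⟨z, hz, rfl⟩ := hk
  exact ⟨z, hz.1, (hfin z hz.1).cast_ncard_eq.symm⟩

theorem GInf.subset_window (Z : GInf q ζm ζp) : ∃ R, Z.1 ⊆ window q ζm ζp R := by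
  obtain ⟨a, b, hab⟩ := Z.2.2.2
  exact ⟨max |a| |b|, fun x hx => ⟨Z.2.1 hx, abs_le_max_abs_abs (hab hx).1 (hab hx).2⟩⟩

/-- Rank and membership of a point z of Z depend only on the finitely many lattice points of the
window of modulus at least |z|, where X(n) eventually agrees with Z. -/
theorem Converges.stabilizes (hq : 0 < q) (hq1 : q < 1) (hm : ζm < 0) (hp : 0 < ζp)
    {X : ∀ n, GSpace q ζm ζp n} {Z : GInf q ζm ζp} (h : Converges X Z.1) : Stabilizes X Z := by
  obtain ⟨hconv, R, hR⟩ := h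
  have hZ := hconv.subset_window hR
  intro k
  obtain ⟨z, hz, hk⟩ := exists_encard_predecessors_eq hq hq1 hm hp hZ Z.2.2.1 k
  have hz0 := ne_zero_of_mem_qLattice hq hm hp (hZ hz).1
  have hag : ∀ᶠ n in atTop, ∀ x ∈ {x ∈ window q ζm ζp R | |z| ≤ |x|},
      (x ∈ ((X n).1 : Set ℝ) ↔ x ∈ Z.1) :=
    (eventually_all_finite (finite_window_ge hq hq1 hm hp R (abs_pos.2 hz0))).2 fun x _ => hconv x
  obtain ⟨n₀, hn₀⟩ := eventually_atTop.1 (hag.and hR)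
  refine ⟨n₀, fun n hn => ?_⟩
  obtain ⟨h1, h2⟩ := hn₀ n hn
  rw [varSeries_eq_of_encard hq hq1 hm hp hZ hz hk]
  refine varSeries_eq_of_encard hq hq1 hm hp h2 ((h1 z ⟨hZ hz, le_rfl⟩).2 hz) ?_
  rw [← hk]
  congr 1
  ext y
  constructor
  · exact fun hy => ⟨(h1 y ⟨h2 hy.1, hy.2.abs_le⟩).1 hy.1, hy.2⟩
  · exact fun hy => ⟨(h1 y ⟨hZ hy.1, hy.2.abs_le⟩).2 hy.1, hy.2⟩

/-- Points of Z eventually appear with their correct rank. A foreign point would raise the rank of a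
later point of Z, and the point of rank 0 bounds everything. -/
theorem Stabilizes.converges (hq : 0 < q) (hq1 : q < 1) (hm : ζm < 0) (hp : 0 < ζp)
    {X : ∀ n, GSpace q ζm ζp n} {Z : GInf q ζm ζp} (h : Stabilizes X Z) : Converges X Z.1 := by
  obtain ⟨R, hZ⟩ := Z.subset_window
  have h0 : ∀ z ∈ qLattice q ζm ζp, z ≠ 0 := fun z hz => ne_zero_of_mem_qLattice hq hm hp hz
  have hrank : ∀ z ∈ Z.1, ∀ k : ℕ, (predecessors Z.1 z).encard = k → ∀ᶠ n in atTop,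
      z ∈ ((X n).1 : Set ℝ) ∧ (predecessors ((X n).1 : Set ℝ) z).encard = k := by
    intro z hz k hk
    obtain ⟨n₀, hn₀⟩ := h k
    filter_upwards [eventually_ge_atTop n₀] with n hn
    have h1 := hn₀ n hn
    rw [varSeries_eq_of_encard hq hq1 hm hp hZ hz hk] at h1
    -- Lattice points are nonzero, so the value z cannot be the default 0 of `varSeries`.
    have := mem_of_varSeries_ne_zero (h1.trans_ne (h0 z (hZ hz).1))
    rwa [h1] at this
  have hmem : ∀ z ∈ Z.1, ∀ᶠ n in atTop, z ∈ ((X n).1 : Set ℝ) := fun z hz =>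
    (hrank z hz _ (finite_predecessors hq hq1 hm hp hZ (h0 z (hZ hz).1)).cast_ncard_eq.symm).mono
      fun n hn => hn.1
  constructor
  · intro x
    by_cases hx : x ∈ Z.1
    · exact (hmem x hx).mono fun n hn => ⟨fun _ => hx, fun _ => hn⟩
    by_cases hxL : x ∈ qLattice q ζm ζp
    swap
    · exact Eventually.of_forall fun n => ⟨fun h' => absurd ((X n).2.1 h') hxL,
        fun h' => absurd h' hx⟩
    have hfin := finite_predecessors hq hq1 hm hp hZ (h0 x hxL)
    -- If k points of Z precede x ∉ Z, the point z of rank k comes after x. Were x in X(n), it would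
    -- be a predecessor of z in addition to the k points of Z before z.
    obtain ⟨z, hz, hk⟩ := exists_encard_predecessors_eq hq hq1 hm hp hZ Z.2.2.1
      (predecessors Z.1 x).ncard
    have hfz := finite_predecessors hq hq1 hm hp hZ (h0 z (hZ hz).1)
    have hxz : Before x z := by
      rcases before_trichotomy x z with h' | h' | h'
      · exact h'
      · exact absurd (h' ▸ hz) hx
      · have := hfz.encard_lt_encard (predecessors_ssubset hz h')
        rw [hk, hfin.cast_ncard_eq] at this
        exact absurd this (lt_irrefl _)
    have hev : ∀ᶠ n in atTop, ∀ y ∈ predecessors Z.1 z, y ∈ ((X n).1 : Set ℝ) :=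
      (eventually_all_finite hfz).2 fun y hy => hmem y hy.1
    filter_upwards [hrank z hz _ hk, hev] with n hn hn'
    refine ⟨fun hxn => ?_, fun h' => absurd h' hx⟩
    have hss : predecessors Z.1 z ⊂ predecessors ((X n).1 : Set ℝ) z :=
      Set.ssubset_iff_exists.2
        ⟨fun y hy => ⟨hn' y hy, hy.2⟩, x, ⟨hxn, hxz⟩, fun h' => hx h'.1⟩
    have := hfz.encard_lt_encard hss
    rw [hk, hn.2] at this
    exact absurd this (lt_irrefl _)
  · obtain ⟨z, hz, hk⟩ := exists_encard_predecessors_eq hq hq1 hm hp hZ Z.2.2.1 0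
    refine ⟨|z|, (hrank z hz 0 hk).mono fun n hn x hx => ⟨(X n).2.1 hx, ?_⟩⟩
    have hempty : predecessors ((X n).1 : Set ℝ) z = ∅ := by
      rw [← Set.encard_eq_zero]
      simpa using hn.2
    rcases before_trichotomy x z with h' | h' | h'
    · have : x ∈ predecessors ((X n).1 : Set ℝ) z := ⟨hx, h'⟩
      rw [hempty] at this
      exact absurd this (Set.notMem_empty x)
    · rw [h']
    · exact h'.abs_le

theorem Converges.unique {X : ∀ n, GSpace q ζm ζp n} {Z Z' : Set ℝ} (h : Converges X Z)
    (h' : Converges X Z') : Z = Z' := by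
  ext x
  obtain ⟨n, hn, hn'⟩ := ((h.1 x).and (h'.1 x)).exists
  exact hn.symm.trans hn'

/-- The first n + 1 terms of the variational series of Z form the approximating configurations. -/
theorem exists_converges (hq : 0 < q) (hq1 : q < 1) (hm : ζm < 0) (hp : 0 < ζp)
    (Z : GInf q ζm ζp) : ∃ X : ∀ n, GSpace q ζm ζp n, Converges X Z.1 := by
  classical
  obtain ⟨R, hZ⟩ := Z.subset_window
  choose z hz hk using exists_encard_predecessors_eq hq hq1 hm hp hZ Z.2.2.1
  have hinj : Function.Injective z := fun k k' h => by
    have := hk k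
    rw [h, hk k'] at this
    exact_mod_cast this.symm
  refine ⟨fun n => ⟨(Finset.range (n + 1)).image z, ?_, ?_⟩, fun x => ?_, R, ?_⟩
  · intro x hx
    obtain ⟨k, -, rfl⟩ := Finset.mem_image.1 hx
    exact Z.2.1 (hz k)
  · rw [Finset.card_image_of_injective _ hinj, Finset.card_range]
  · by_cases hx : x ∈ Z.1
    · have hfin := finite_predecessors hq hq1 hm hp hZ
        (ne_zero_of_mem_qLattice hq hm hp (Z.2.1 hx))
      have hxk : x = z (predecessors Z.1 x).ncard :=
        (varSeries_eq_of_encard hq hq1 hm hp hZ hx hfin.cast_ncard_eq.symm).symm.trans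
          (varSeries_eq_of_encard hq hq1 hm hp hZ (hz _) (hk _))
      filter_upwards [eventually_ge_atTop (predecessors Z.1 x).ncard] with n hn
      refine ⟨fun _ => hx, fun _ => ?_⟩
      exact Finset.mem_coe.2 (Finset.mem_image.2
        ⟨_, Finset.mem_range.2 (Nat.lt_succ_of_le hn), hxk.symm⟩)
    · refine Eventually.of_forall fun n => ⟨fun h => ?_, fun h => absurd h hx⟩
      obtain ⟨k, -, rfl⟩ := Finset.mem_image.1 (Finset.mem_coe.1 h)
      exact hz k
  · refine Eventually.of_forall fun n x hx => ?_
    obtain ⟨k, -, rfl⟩ := Finset.mem_image.1 (Finset.mem_coe.1 hx)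
    exact hZ (hz k)

/-! ### The Martin boundary -/

theorem isRegular_iff (hq : 0 < q) (hq1 : q < 1) (hm : ζm < 0) (hp : 0 < ζp)
    (X : ∀ n, GSpace q ζm ζp n) :
    IsRegular (Ω := GSpace q ζm ζp) (qLink q ζm ζp) X ↔
      ∃ Z : GInf q ζm ζp, Stabilizes X Z := by
  constructor
  · intro h
    obtain ⟨Z, hinf, hZ⟩ := exists_converges_of_isRegular hq hq1 hm hp h
    obtain ⟨R, hR⟩ := hZ.2
    have hW := hZ.1.subset_window hR
    exact ⟨⟨Z, fun x hx => (hW hx).1, hinf, -R, R, fun x hx => abs_le.1 (hW hx).2⟩,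
      Converges.stabilizes hq hq1 hm hp hZ⟩
  · rintro ⟨Z, hZ⟩ K
    obtain ⟨M, hM, -⟩ := (hZ.converges hq hq1 hm hp).exists_pmf hq hq1 hm hp Z.2.2.1 K
    exact ⟨M, hM⟩

theorem limitMeasure_apply (hq : 0 < q) (hq1 : q < 1) (hm : ζm < 0) (hp : 0 < ζp)
    (X : RegularSeq (Ω := GSpace q ζm ζp) (qLink q ζm ζp)) {Z : GInf q ζm ζp}
    (h : Stabilizes X.1 Z) (K : ℕ) (Y : GSpace q ζm ζp K) :
    0 ≤ limReal K Z.1 Y ∧ limitMeasure (qLink q ζm ζp) X K Y = ENNReal.ofReal (limReal K Z.1 Y) := by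
  obtain ⟨M, hM, hMZ⟩ := (h.converges hq hq1 hm hp).exists_pmf hq hq1 hm hp Z.2.2.1 K
  have hlim : RowsConverge (Ω := GSpace q ζm ζp) (qLink q ζm ζp) X.1 K
    (limitMeasure (qLink q ζm ζp) X K) := (X.2 K).choose_spec
  rw [hlim.unique hM]
  exact hMZ Y

theorem limitMeasure_eq_iff (hq : 0 < q) (hq1 : q < 1) (hm : ζm < 0) (hp : 0 < ζp)
    {X X' : RegularSeq (Ω := GSpace q ζm ζp) (qLink q ζm ζp)} {Z Z' : GInf q ζm ζp}
    (h : Stabilizes X.1 Z) (h' : Stabilizes X'.1 Z') :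
    limitMeasure (qLink q ζm ζp) X = limitMeasure (qLink q ζm ζp) X' ↔ Z = Z' := by
  constructor
  · intro heq
    have hc := h.converges hq hq1 hm hp
    have hc' := h'.converges hq hq1 hm hp
    -- Nonvanishing of the coproducts of an infinite configuration is inherited from finite
    -- approximations, hence the convergent sequence.
    have hne : ∀ (X : ∀ n, GSpace q ζm ζp n) (Z : GInf q ζm ζp), Converges X Z.1 →
        ∀ a ∈ Z.1, coprod Z.1 a ≠ 0 := by
      rintro X Z ⟨h1, R, h2⟩ a ha
      exact abs_pos.1 ((coprodBound_pos (q := q)).trans_le (abs_coprod_ge_of_tendsto hq hq1 hm hp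
        h1 h2 (Eventually.of_forall fun n => Finset.finite_toSet _) (Z.2.1 ha)))
    obtain ⟨R, hR⟩ := Z.subset_window
    obtain ⟨R', hR'⟩ := Z'.subset_window
    have hmono : ∀ {r s : ℝ}, r ≤ s → window q ζm ζp r ⊆ window q ζm ζp s := fun hrs x hx =>
      ⟨hx.1, hx.2.trans hrs⟩
    refine Subtype.ext (eq_of_limReal_zero_eq hq hq1 hm hp (hR.trans (hmono (le_max_left R R')))
      (hR'.trans (hmono (le_max_right R R'))) (hne _ Z hc) (hne _ Z' hc') fun Y => ?_)
    obtain ⟨h1, h2⟩ := limitMeasure_apply hq hq1 hm hp X h 0 Y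
    obtain ⟨h3, h4⟩ := limitMeasure_apply hq hq1 hm hp X' h' 0 Y
    rw [heq, h4] at h2
    exact ((ENNReal.ofReal_eq_ofReal_iff h3 h1).1 h2).symm
  · rintro rfl
    funext K
    refine PMF.ext fun Y => ?_
    rw [(limitMeasure_apply hq hq1 hm hp X h K Y).2, (limitMeasure_apply hq hq1 hm hp X' h' K Y).2]

end

end ExtGT

theorem theorem3p1 (q ζm ζp : ℝ) (hq0 : 0 < q) (hq1 : q < 1) (hm : ζm < 0) (hp : 0 < ζp) :
    (∀ X : ∀ n, ExtGT.GSpace q ζm ζp n,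
      ExtGT.IsRegular (Ω := ExtGT.GSpace q ζm ζp) (ExtGT.qLink q ζm ζp) X ↔
        ∃ Z : ExtGT.GInf q ζm ζp, ExtGT.Stabilizes X Z) ∧
    ∃ Φ : ExtGT.MartinBoundary (Ω := ExtGT.GSpace q ζm ζp) (ExtGT.qLink q ζm ζp) →
        ExtGT.GInf q ζm ζp,
      Function.Bijective Φ ∧
      ∀ (X : ExtGT.RegularSeq (Ω := ExtGT.GSpace q ζm ζp) (ExtGT.qLink q ζm ζp))
        (Z : ExtGT.GInf q ζm ζp),
        Φ (ExtGT.MartinBoundary.mk (ExtGT.qLink q ζm ζp) X) = Z ↔ ExtGT.Stabilizes X.1 Z := by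
  have hreg := ExtGT.isRegular_iff hq0 hq1 hm hp
  refine ⟨hreg, ?_⟩
  choose F hF using fun X : ExtGT.RegularSeq (Ω := ExtGT.GSpace q ζm ζp) (ExtGT.qLink q ζm ζp) =>
    (hreg X.1).1 X.2
  let Φ : ExtGT.MartinBoundary (Ω := ExtGT.GSpace q ζm ζp) (ExtGT.qLink q ζm ζp) →
      ExtGT.GInf q ζm ζp := Quotient.lift F fun X X' h =>
    (ExtGT.limitMeasure_eq_iff hq0 hq1 hm hp (hF X) (hF X')).1 h
  have hΦ : ∀ X, Φ (ExtGT.MartinBoundary.mk (ExtGT.qLink q ζm ζp) X) = F X := fun X => rfl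
  have hiff : ∀ (X : ExtGT.RegularSeq (Ω := ExtGT.GSpace q ζm ζp) (ExtGT.qLink q ζm ζp))
      (Z : ExtGT.GInf q ζm ζp),
      Φ (ExtGT.MartinBoundary.mk (ExtGT.qLink q ζm ζp) X) = Z ↔ ExtGT.Stabilizes X.1 Z := by
    intro X Z
    rw [hΦ]
    refine ⟨fun h => h ▸ hF X, fun h => Subtype.ext ?_⟩
    exact ((hF X).converges hq0 hq1 hm hp).unique (h.converges hq0 hq1 hm hp)
  refine ⟨Φ, ⟨?_, fun Z => ?_⟩, hiff⟩
  · intro a b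
    refine Quotient.inductionOn₂ a b fun X X' h => Quotient.sound ?_
    exact (ExtGT.limitMeasure_eq_iff hq0 hq1 hm hp (hF X) (hF X')).2 h
  · obtain ⟨X, hX⟩ := ExtGT.exists_converges hq0 hq1 hm hp Z
    have hs := hX.stabilizes hq0 hq1 hm hp
    exact ⟨ExtGT.MartinBoundary.mk (ExtGT.qLink q ζm ζp) ⟨X, (hreg X).2 ⟨Z, hs⟩⟩, (hiff _ Z).2 hs⟩
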